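/- **Definitions.** For a locally Lipschitz flux $f:\mathbb R\to\mathbb R$ consider $$u_t+f(u)_x=0\quad (t>0,\ x\in\mathbb R),\qquad u(0,\cdot)=u^0. \tag{1}$$ * A function $u\in L^\infty([0,\infty[\times\mathbb R)$ is an *entropy solution* of (1) if, for every convex Lipschitz $E:\mathbb R\to\mathbb R$, with $F(w)=\int_0^w f'(v)E'(v)\,dv$, and every nonnegative $\varphi\in\mathcal C_c^\infty([0,\infty[\times\mathbb R)$, $$\int_0^{\infty}\!\!\int_{\mathbb R}\bigl(E(u)\varphi_t+F(u)\varphi_x\bigr)\,dx\,dt+\int_{\mathbb R}E(u^0(x))\varphi(0,x)\,dx\ \ge 0 .$$ *The* entropy solution associated with $u^0$ is the unique entropy solution of (1) belonging to $L^\infty([0,\infty[\times\mathbb R)\cap\mathcal C([0,\infty[,L^1_{loc}(\mathbb R))$; for each $t\ge0$ the function $u(t,\cdot)$ is determined up to a Lebesgue-null set. * A *classical solution* of (1) is a function $u\in\mathcal C^1(]0,\infty[\times\mathbb R)\cap\mathcal C([0,\infty[\times\mathbb R)$ satisfying (1) pointwise. * $\mathcal U$ is the set of nondecreasing right-continuous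 functions $v:\mathbb R\to\mathbb R$ with limits $0$ at $-\infty$ and $1$ at $+\infty$. The distributional derivative $v_x$ of $v\in\mathcal U$ is the Borel probability measure with $v_x(]-\infty,x])=v(x)$ for all $x$. For $p\ge1$, $\mathcal U_p$ is the set of $v\in\mathcal U$ with $\int_{\mathbb R}|x|^p\,dv_x(x)<\infty$. * For Borel probability measures $\mu,\tilde\mu$ on $\mathbb R$, $W_p(\mu,\tilde\mu)=\inf_\pi\bigl(\int_{\mathbb R^2}|x-y|^p\,d\pi(x,y)\bigr)^{1/p}\in[0,\infty]$, where $\pi$ runs over the probability measures on $\mathbb R^2$ with marginals $\mu$ and $\tilde\mu$. **Statement.** Let $f:\mathbb R\to\mathbb R$ be convex and of class $\mathcal C^2$, let $p\ge1$ be real, and let $u^0,\tilde u^0\in\mathcal U_p$ be of class $\mathcal C^1$ and (strictly) increasing. Then the associated entropy solutions $u$ and $\tilde u$ exist and are unique, and, choosing suitable representatives: 1. $u$ and $\tilde u$ are classical solutions of (1) with initial data $u^0$ and $\tilde u^0$ respectively; 2. for all $t\ge0$, $u(t,\cdot)$ and $\tilde u(t,\cdot)$ belong to $\mathcal U_p$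 and are (strictly) increasing; 3. for all $t\ge0$, $$W_p\bigl(u_x(t,\cdot),\tilde u_x(t,\cdot)\bigr)=W_p\bigl(u^0_x,\tilde u^0_x\bigr)<\infty .$$ -/

import Mathlib

open MeasureTheory Set Filter Topology
open scoped NNReal ContDiff

namespace ConservationLaw

/-! ### The scalar conservation law `u_t + f(u)_x = 0`

A function of time and space is a map `u : ℝ → ℝ → ℝ`, `u t x`; only its values at `t ≥ 0`
matter. -/

/-- The entropy flux `F(w) = ∫_0^w f'(v) E'(v) dv` associated with the entropy `E`.
(The derivatives of the locally Lipschitz functions `f` and `E` exist almost everywhere.) -/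
noncomputable def entropyFlux (f E : ℝ → ℝ) (w : ℝ) : ℝ :=
  ∫ v in (0 : ℝ)..w, deriv f v * deriv E v

/-- `u` is an entropy solution of `u_t + f(u)_x = 0` on `[0,∞[ × ℝ` with initial datum `u₀`:
`u ∈ L^∞([0,∞[ × ℝ)` and `E(u)_t + F(u)_x ≤ 0` in the sense of distributions, initial datum
included, for every convex Lipschitz `E : ℝ → ℝ`.  The test functions are the restrictions to
`[0,∞[ × ℝ` of smooth compactly supported functions on `ℝ × ℝ`, nonnegative on
`[0,∞[ × ℝ`. -/
structure IsEntropySolution (f u₀ : ℝ → ℝ) (u : ℝ → ℝ → ℝ) : Prop where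
  memLp_top : MemLp (fun z : ℝ × ℝ => u z.1 z.2) ⊤ (volume.restrict (Ici 0 ×ˢ univ))
  entropy_ineq : ∀ E : ℝ → ℝ, ConvexOn ℝ univ E → (∃ K : ℝ≥0, LipschitzWith K E) →
    ∀ φ : ℝ × ℝ → ℝ, ContDiff ℝ ∞ φ → HasCompactSupport φ →
      (∀ t x : ℝ, 0 ≤ t → 0 ≤ φ (t, x)) →
      0 ≤ (∫ z in (Ioi 0 ×ˢ univ : Set (ℝ × ℝ)),
            (E (u z.1 z.2) * fderiv ℝ φ z (1, 0)
              + entropyFlux f E (u z.1 z.2) * fderiv ℝ φ z (0, 1)))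
          + ∫ x : ℝ, E (u₀ x) * φ (0, x)

/-- `u ∈ C([0,∞[, L¹_loc(ℝ))`. -/
structure ContinuousInL1Loc (u : ℝ → ℝ → ℝ) : Prop where
  locallyIntegrable : ∀ t : ℝ, 0 ≤ t → LocallyIntegrable (u t) volume
  tendsto : ∀ R t : ℝ, 0 ≤ t →
    Tendsto (fun s => ∫⁻ x in Icc (-R) R, ‖u s x - u t x‖ₑ) (𝓝[Ici 0] t) (𝓝 0)

/-- `u` is a representative of the entropy solution of `u_t + f(u)_x = 0` with datum `u₀`: it is
an entropy solution in `L^∞([0,∞[ × ℝ) ∩ C([0,∞[, L¹_loc(ℝ))`, and it is the only one, up to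
Lebesgue-null sets of `ℝ` at every time. -/
structure IsTheEntropySolution (f u₀ : ℝ → ℝ) (u : ℝ → ℝ → ℝ) : Prop where
  isEntropySolution : IsEntropySolution f u₀ u
  continuousInL1Loc : ContinuousInL1Loc u
  unique : ∀ w : ℝ → ℝ → ℝ, IsEntropySolution f u₀ w → ContinuousInL1Loc w →
    ∀ t : ℝ, 0 ≤ t → w t =ᵐ[volume] u t

/-- `u` is a classical solution of `u_t + f(u)_x = 0` with initial datum `u₀`:
`u ∈ C¹(]0,∞[ × ℝ) ∩ C([0,∞[ × ℝ)` satisfies the equation and the initial condition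
pointwise. -/
structure IsClassicalSolution (f u₀ : ℝ → ℝ) (u : ℝ → ℝ → ℝ) : Prop where
  contDiffOn : ContDiffOn ℝ 1 (fun z : ℝ × ℝ => u z.1 z.2) (Ioi 0 ×ˢ univ)
  continuousOn : ContinuousOn (fun z : ℝ × ℝ => u z.1 z.2) (Ici 0 ×ˢ univ)
  equation : ∀ t x : ℝ, 0 < t →
    deriv (fun s => u s x) t + deriv (fun y => f (u t y)) x = 0
  initial : ∀ x : ℝ, u 0 x = u₀ x

/-! ### The sets `𝒰` and `𝒰_p`, and the Wasserstein distance -/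

/-- The set `𝒰` of nondecreasing right-continuous functions with limits `0` at `-∞` and `1`
at `+∞`. -/
structure MemU (v : ℝ → ℝ) : Prop where
  mono : Monotone v
  rightCont : ∀ x : ℝ, ContinuousWithinAt v (Ici x) x
  tendsto_atBot : Tendsto v atBot (𝓝 0)
  tendsto_atTop : Tendsto v atTop (𝓝 1)

/-- The element `v` of `𝒰` as a Stieltjes function. -/
noncomputable def MemU.stieltjes {v : ℝ → ℝ} (h : MemU v) : StieltjesFunction ℝ :=
  ⟨v, h.mono, h.rightCont⟩

open Classical in
/-- The space derivative `v_x` of `v ∈ 𝒰`: the Borel measure with `v_x(]a,b]) = v(b) - v(a)`.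
It is a probability measure (`MemU.isProbabilityMeasure`) and the distributional derivative
of `v` (`MemU.integral_spaceDeriv`); outside `𝒰` the value is the irrelevant `0`. -/
noncomputable def spaceDeriv (v : ℝ → ℝ) : Measure ℝ :=
  if h : MemU v then h.stieltjes.measure else 0

/-- The set `𝒰_p` of those `v ∈ 𝒰` for which `∫ |x|^p dv_x(x)` is finite. -/
def MemUp (p : ℝ) (v : ℝ → ℝ) : Prop :=
  MemU v ∧ ∫⁻ x, ENNReal.ofReal (|x| ^ p) ∂(spaceDeriv v) < ⊤

/-- The Wasserstein distance of order `p` on `ℝ`, with values in `[0,∞]`: the infimum of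
`(∫ |x - y|^p dπ(x,y))^(1/p)` over the probability measures `π` on `ℝ²` with marginals
`μ` and `ν`. -/
noncomputable def wasserstein (p : ℝ) (μ ν : Measure ℝ) : ENNReal :=
  ⨅ π ∈ {π : Measure (ℝ × ℝ) |
      IsProbabilityMeasure π ∧ π.map Prod.fst = μ ∧ π.map Prod.snd = ν},
    (∫⁻ z, ENNReal.ofReal (|z.1 - z.2| ^ p) ∂π) ^ (1 / p)

theorem MemU.isProbabilityMeasure {v : ℝ → ℝ} (h : MemU v) :
    IsProbabilityMeasure (spaceDeriv v) := by
  rw [spaceDeriv, dif_pos h]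
  exact StieltjesFunction.isProbabilityMeasure _ h.tendsto_atBot h.tendsto_atTop

theorem MemU.spaceDeriv_Iic {v : ℝ → ℝ} (h : MemU v) (x : ℝ) :
    spaceDeriv v (Iic x) = ENNReal.ofReal (v x) := by
  rw [spaceDeriv, dif_pos h, StieltjesFunction.measure_Iic _ h.tendsto_atBot x, sub_zero]
  rfl

/-- `spaceDeriv v` is the derivative of `v` in the sense of distributions. -/
theorem MemU.integral_spaceDeriv {v : ℝ → ℝ} (h : MemU v) {φ : ℝ → ℝ}
    (hφ : ContDiff ℝ ∞ φ) (hc : HasCompactSupport φ) :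
    ∫ x, φ x ∂(spaceDeriv v) = - ∫ x, v x * deriv φ x := by
  have := h.isProbabilityMeasure
  have h1 : ContDiff ℝ 1 φ := hφ.of_le (by exact_mod_cast le_top)
  have hd : Continuous (deriv φ) := h1.continuous_deriv le_rfl
  have hi : Integrable (deriv φ) volume := hd.integrable_of_hasCompactSupport hc.deriv
  have hS : MeasurableSet {z : ℝ × ℝ | z.1 < z.2} :=
    measurableSet_lt measurable_fst measurable_snd
  have e1 : ∀ x, φ x = - ∫ y, {z : ℝ × ℝ | z.1 < z.2}.indicator (fun z => deriv φ z.2) (x, y) := by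
    intro x
    have : (fun y => {z : ℝ × ℝ | z.1 < z.2}.indicator (fun z => deriv φ z.2) (x, y))
        = (Ioi x).indicator (deriv φ) := by
      ext y; simp [indicator]
    rw [this, integral_indicator measurableSet_Ioi,
      HasCompactSupport.integral_Ioi_deriv_eq h1 hc x, neg_neg]
  have hint : Integrable (fun z : ℝ × ℝ => {z : ℝ × ℝ | z.1 < z.2}.indicator
      (fun z => deriv φ z.2) z) ((spaceDeriv v).prod volume) :=
    (hi.comp_snd (spaceDeriv v)).indicator hS
  have hne : ∀ᵐ y : ℝ, spaceDeriv v {y} = 0 := by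
    have hcount : {y : ℝ | spaceDeriv v {y} ≠ 0}.Countable := by
      have := Measure.countable_meas_pos_of_disjoint_iUnion (μ := spaceDeriv v)
        (As := fun y : ℝ => {y}) (fun y => measurableSet_singleton y)
        (fun a b hab => by simpa using hab)
      simpa [pos_iff_ne_zero] using this
    simpa [ae_iff] using hcount.measure_zero volume
  calc ∫ x, φ x ∂(spaceDeriv v)
      = - ∫ x, ∫ y, {z : ℝ × ℝ | z.1 < z.2}.indicator (fun z => deriv φ z.2) (x, y)
          ∂volume ∂(spaceDeriv v) := by rw [← integral_neg]; exact integral_congr_ae (.of_forall e1)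
    _ = - ∫ y, ∫ x, {z : ℝ × ℝ | z.1 < z.2}.indicator (fun z => deriv φ z.2) (x, y)
          ∂(spaceDeriv v) ∂volume := by rw [integral_integral_swap hint]
    _ = - ∫ x, v x * deriv φ x := by
      congr 1
      refine integral_congr_ae ?_
      filter_upwards [hne] with y hy
      have e2 : (fun x => {z : ℝ × ℝ | z.1 < z.2}.indicator (fun z => deriv φ z.2) (x, y))
          = (Iio y).indicator (fun _ => deriv φ y) := by
        ext x; simp [indicator]
      have e3 : spaceDeriv v (Iio y) = spaceDeriv v (Iic y) := by
        refine le_antisymm (measure_mono Iio_subset_Iic_self) ?_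
        rw [← Iio_union_right]
        exact (measure_union_le _ _).trans (by rw [hy, add_zero])
      rw [e2, integral_indicator measurableSet_Iio, setIntegral_const, measureReal_def, e3,
        h.spaceDeriv_Iic, ENNReal.toReal_ofReal (h.mono.le_of_tendsto h.tendsto_atBot y),
        smul_eq_mul]

end ConservationLaw

/-! Since `f'` is nondecreasing and the datum increasing, the characteristics `y + t f'(u₀ y)`
spread apart. They never cross, and carrying `u₀` along them gives a `C¹` solution at all times. A
level `k` then travels at the constant speed `f'(k)`, so the quantile function becomes `q k + t
f'(k)` (`isQuantile_charSol`). This displacement depends on `k` alone, hence the difference of the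
quantile functions of two solutions does not depend on time. As `W_p` on the line is the
`L^p(]0,1[)` norm of that difference (`wasserstein_map_unif`), it is conserved.

The formula for `W_p` rests on writing `|x - y|^p` as a superposition of indicators of quadrants `{x
< s, r < y}` and their mirror images. The mass of a quadrant is bounded below by the marginals, and
the monotone coupling attains the bound.

For the entropy inequality, `E(u)` and its flux are split into levels `k`. Each set `{u > k}` is a
half-plane bounded by a straight line of speed `f'(k)`, which gives an equality (`entropy_eq`).

Uniqueness needs no doubling of variables: testing with the entropies `(w - k)⁺` and `(k - w)⁺`,
convexity of `f` forces any entropy solution to be `≤ k` to the left of the line of level `k` and `≥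
k` to its right (`ae_le`, `ae_ge`). Rational levels determine it almost everywhere, and continuity
in time at every `t`. -/

namespace ConservationLaw

/-! ### Optimality of the monotone coupling on the line -/

/-- Lebesgue measure on `]0,1[`, the law of the uniform variable of quantile couplings. -/
noncomputable def unif : Measure ℝ := volume.restrict (Ioo 0 1)

instance : IsProbabilityMeasure unif := ⟨by simp [unif]⟩

theorem aemeasurable_unif {q : ℝ → ℝ} (hq : MonotoneOn q (Ioo 0 1)) : AEMeasurable q unif :=
  aemeasurable_restrict_of_monotoneOn measurableSet_Ioo hq

/-- By monotonicity both sublevel sets are initial segments of `]0,1[`, hence nested. A point of the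
first outside the second forces the second into the first; without such a point the left side is
zero. -/
theorem unif_inter_le {q₁ q₂ : ℝ → ℝ} (h₁ : MonotoneOn q₁ (Ioo 0 1))
    (h₂ : MonotoneOn q₂ (Ioo 0 1)) (s r : ℝ) :
    unif {k | q₁ k < s ∧ r < q₂ k} ≤ unif {k | q₁ k < s} - unif {k | q₂ k ≤ r} := by
  have hI : ∀ᵐ k ∂unif, k ∈ Ioo (0 : ℝ) 1 := ae_restrict_mem measurableSet_Ioo
  by_cases h : ∃ k ∈ Ioo (0 : ℝ) 1, q₁ k < s ∧ r < q₂ k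
  · obtain ⟨k, hk, hks, hkr⟩ := h
    have hm : NullMeasurableSet {k | q₂ k ≤ r} unif :=
      (aemeasurable_unif h₂).nullMeasurableSet_preimage measurableSet_Iic
    have hsub : ∀ᵐ j ∂unif, j ∈ {k | q₂ k ≤ r} → j ∈ {k | q₁ k < s} := by
      filter_upwards [hI] with j hj hjr
      have hjk : j ≤ k := by
        by_contra! hlt
        exact absurd (h₂ hk hj hlt.le) (not_le.2 (lt_of_le_of_lt hjr hkr))
      exact lt_of_le_of_lt (h₁ hj hk hjk) hks
    refine ENNReal.le_sub_of_add_le_right (measure_ne_top _ _) ?_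
    rw [← measure_union₀ hm]
    · refine measure_mono_ae ?_
      filter_upwards [hsub] with j hj hmem
      rcases hmem with hmem | hmem
      exacts [hmem.1, hj hmem]
    · refine Disjoint.aedisjoint (disjoint_left.2 ?_)
      intro j hj hj'
      exact not_lt.2 hj' hj.2
  · push Not at h
    have : unif {k | q₁ k < s ∧ r < q₂ k} = 0 := by
      rw [← nonpos_iff_eq_zero, ← measure_empty (μ := unif)]
      refine measure_mono_ae ?_
      filter_upwards [hI] with j hj hmem
      exact absurd hmem.2 (not_lt.2 (h j hj hmem.1))
    rw [this]; exact zero_le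

/-- The lower bound of `unif_inter_le` involves only the marginals, so every coupling gives the
quadrant at least that mass. -/
theorem unif_inter_le_coupling {q₁ q₂ : ℝ → ℝ} (h₁ : MonotoneOn q₁ (Ioo 0 1))
    (h₂ : MonotoneOn q₂ (Ioo 0 1)) {π : Measure (ℝ × ℝ)}
    (hπ₁ : π.map Prod.fst = unif.map q₁) (hπ₂ : π.map Prod.snd = unif.map q₂) (s r : ℝ) :
    unif {k | q₁ k < s ∧ r < q₂ k} ≤ π {z | z.1 < s ∧ r < z.2} := by
  have e₁ : unif {k | q₁ k < s} = π {z | z.1 < s} := by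
    have := congrArg (fun m => m (Iio s)) hπ₁
    simp only [Measure.map_apply measurable_fst measurableSet_Iio,
      Measure.map_apply_of_aemeasurable (aemeasurable_unif h₁) measurableSet_Iio] at this
    exact this.symm
  have e₂ : unif {k | q₂ k ≤ r} = π {z | z.2 ≤ r} := by
    have := congrArg (fun m => m (Iic r)) hπ₂
    simp only [Measure.map_apply measurable_snd measurableSet_Iic,
      Measure.map_apply_of_aemeasurable (aemeasurable_unif h₂) measurableSet_Iic] at this
    exact this.symm
  refine (unif_inter_le h₁ h₂ s r).trans ?_
  rw [e₁, e₂, tsub_le_iff_right]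
  refine (measure_mono ?_).trans (measure_union_le _ _)
  intro z hz
  rcases lt_or_ge r z.2 with h | h
  exacts [Or.inl ⟨hz, h⟩, Or.inr h]

theorem measurableSet_lt_and_lt {α : Type*} [MeasurableSpace α] {a b c d : α → ℝ}
    (ha : Measurable a) (hb : Measurable b) (hc : Measurable c) (hd : Measurable d) :
    MeasurableSet {x | a x < b x ∧ c x < d x} :=
  MeasurableSet.inter (measurableSet_lt ha hb) (measurableSet_lt hc hd)

/-- The positive part of `y - x - κ` is the length of `]x, y - κ[`; Tonelli then reduces this cost
to quadrants. -/
theorem lintegral_ofReal_sub_sub {m : Measure (ℝ × ℝ)} [SFinite m] (κ : ℝ) :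
    ∫⁻ z, ENNReal.ofReal (z.2 - z.1 - κ) ∂m = ∫⁻ s, m {z | z.1 < s ∧ s + κ < z.2} := by
  have hS : MeasurableSet {y : (ℝ × ℝ) × ℝ | y.1.1 < y.2 ∧ y.2 + κ < y.1.2} :=
    measurableSet_lt_and_lt (by fun_prop) (by fun_prop) (by fun_prop) (by fun_prop)
  have h1 : ∀ z : ℝ × ℝ, ENNReal.ofReal (z.2 - z.1 - κ)
      = ∫⁻ s, {y : (ℝ × ℝ) × ℝ | y.1.1 < y.2 ∧ y.2 + κ < y.1.2}.indicator 1 (z, s) := by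
    intro z
    have : (fun s => {y : (ℝ × ℝ) × ℝ | y.1.1 < y.2 ∧ y.2 + κ < y.1.2}.indicator
        (1 : (ℝ × ℝ) × ℝ → ENNReal) (z, s)) = (Ioo z.1 (z.2 - κ)).indicator 1 := by
      ext s; simp only [indicator, mem_ofPred_eq, mem_Ioo, lt_sub_iff_add_lt, Pi.one_apply]
    rw [this, lintegral_indicator_one measurableSet_Ioo, Real.volume_Ioo]
    congr 1; ring
  simp_rw [h1]
  rw [lintegral_lintegral_swap]
  · refine lintegral_congr fun s => ?_
    rw [← lintegral_indicator_one]
    · rfl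
    · exact measurableSet_lt_and_lt (by fun_prop) (by fun_prop) (by fun_prop) (by fun_prop)
  · exact (measurable_one.indicator hS).aemeasurable

/-- The monotone coupling of the quantile functions `q₁` and `q₂`. -/
noncomputable def quantileCoupling (q₁ q₂ : ℝ → ℝ) : Measure (ℝ × ℝ) :=
  unif.map fun k => (q₁ k, q₂ k)

theorem lintegral_ofReal_sub_sub_le {q₁ q₂ : ℝ → ℝ} (h₁ : MonotoneOn q₁ (Ioo 0 1))
    (h₂ : MonotoneOn q₂ (Ioo 0 1)) {π : Measure (ℝ × ℝ)} [SFinite π]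
    (hπ₁ : π.map Prod.fst = unif.map q₁) (hπ₂ : π.map Prod.snd = unif.map q₂) (κ : ℝ) :
    ∫⁻ z, ENNReal.ofReal (z.2 - z.1 - κ) ∂(quantileCoupling q₁ q₂)
      ≤ ∫⁻ z, ENNReal.ofReal (z.2 - z.1 - κ) ∂π := by
  have : SFinite (quantileCoupling q₁ q₂) := by unfold quantileCoupling; infer_instance
  rw [lintegral_ofReal_sub_sub, lintegral_ofReal_sub_sub]
  refine lintegral_mono fun s => ?_
  have := unif_inter_le_coupling h₁ h₂ hπ₁ hπ₂ s (s + κ)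
  rwa [quantileCoupling, Measure.map_apply_of_aemeasurable
    ((aemeasurable_unif h₁).prodMk (aemeasurable_unif h₂))]
  exact measurableSet_lt_and_lt (by fun_prop) (by fun_prop) (by fun_prop) (by fun_prop)

/-- Taylor's formula with integral remainder for `d ↦ (d⁺)^p`: the weight is the second derivative
of `κ^p`, nonnegative and integrable at `0` because `p - 2 > -1`. -/
theorem ofReal_max_rpow_eq_lintegral {p : ℝ} (hp : 1 < p) (d : ℝ) :
    ENNReal.ofReal (max d 0 ^ p)
      = ∫⁻ κ in Ioi (0 : ℝ), ENNReal.ofReal (p * (p - 1) * κ ^ (p - 2))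
          * ENNReal.ofReal (d - κ) := by
  rcases le_or_gt d 0 with hd | hd
  · rw [max_eq_right hd, Real.zero_rpow (by linarith), ENNReal.ofReal_zero, eq_comm,
      ← lintegral_zero (μ := volume.restrict (Ioi (0 : ℝ)))]
    refine setLIntegral_congr_fun measurableSet_Ioi fun κ hκ => ?_
    rw [ENNReal.ofReal_of_nonpos (p := d - κ) (by linarith [mem_Ioi.1 hκ]), mul_zero]
  rw [max_eq_left hd.le]
  have hsplit : Ioi (0 : ℝ) = Ioc 0 d ∪ Ioi d := (Ioc_union_Ioi_eq_Ioi hd.le).symm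
  have hz : ∫⁻ κ in Ioi d, ENNReal.ofReal (p * (p - 1) * κ ^ (p - 2))
          * ENNReal.ofReal (d - κ) = 0 := by
    rw [← lintegral_zero (μ := volume.restrict (Ioi d))]
    refine setLIntegral_congr_fun measurableSet_Ioi fun κ hκ => ?_
    rw [ENNReal.ofReal_of_nonpos (p := d - κ) (by linarith [mem_Ioi.1 hκ]), mul_zero]
  rw [hsplit, lintegral_union measurableSet_Ioi
    (disjoint_left.2 fun x hx hx' => not_lt.2 hx.2 hx'), hz, add_zero]
  have i1 : IntervalIntegrable (fun κ : ℝ => κ ^ (p - 2)) volume 0 d :=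
    intervalIntegral.intervalIntegrable_rpow' (by linarith)
  have i2 : IntervalIntegrable (fun κ : ℝ => κ ^ (p - 1)) volume 0 d :=
    intervalIntegral.intervalIntegrable_rpow' (by linarith)
  have i3 : IntervalIntegrable
      (fun κ : ℝ => p * (p - 1) * d * κ ^ (p - 2) - p * (p - 1) * κ ^ (p - 1)) volume 0 d :=
    (i1.const_mul _).sub (i2.const_mul _)
  have hval : ∫ κ in (0 : ℝ)..d, (p * (p - 1) * d * κ ^ (p - 2) - p * (p - 1) * κ ^ (p - 1))
      = d ^ p := by
    rw [intervalIntegral.integral_sub (i1.const_mul _) (i2.const_mul _),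
      intervalIntegral.integral_const_mul, intervalIntegral.integral_const_mul,
      integral_rpow (Or.inl (by linarith)), integral_rpow (Or.inl (by linarith)),
      Real.zero_rpow (by linarith), Real.zero_rpow (by linarith)]
    have e1 : p - 2 + 1 = p - 1 := by ring
    have e2 : p - 1 + 1 = p := by ring
    have e3 : d ^ p = d * d ^ (p - 1) := by
      rw [← Real.rpow_one_add' hd.le (by linarith)]; congr 1; ring
    have : p - 1 ≠ 0 := by linarith
    have : p ≠ 0 := by linarith
    rw [e1, e2, e3]
    field_simp
    ring
  have hval' : ∫⁻ κ in Ioc 0 d, ENNReal.ofReal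
      (p * (p - 1) * d * κ ^ (p - 2) - p * (p - 1) * κ ^ (p - 1)) = ENNReal.ofReal (d ^ p) := by
    rw [← hval, intervalIntegral.integral_of_le hd.le, ofReal_integral_eq_lintegral_ofReal i3.1]
    refine (ae_restrict_iff' measurableSet_Ioc).2 (Eventually.of_forall fun κ hκ => ?_)
    have e : κ ^ (p - 1) = κ * κ ^ (p - 2) := by
      rw [← Real.rpow_one_add' hκ.1.le (by linarith)]; congr 1; ring
    have : 0 ≤ p * (p - 1) * κ ^ (p - 2) * (d - κ) :=
      mul_nonneg (mul_nonneg (by nlinarith) (Real.rpow_nonneg hκ.1.le _)) (by linarith [hκ.2])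
    simp only [Pi.zero_apply]
    rw [e]; linarith
  rw [← hval']
  refine setLIntegral_congr_fun measurableSet_Ioc fun κ hκ => ?_
  have e : κ ^ (p - 1) = κ * κ ^ (p - 2) := by
    rw [← Real.rpow_one_add' hκ.1.le (by linarith)]; congr 1; ring
  rw [← ENNReal.ofReal_mul (mul_nonneg (by nlinarith) (Real.rpow_nonneg hκ.1.le _)), e]
  congr 1; ring

theorem lintegral_max_rpow_le {q₁ q₂ : ℝ → ℝ} (h₁ : MonotoneOn q₁ (Ioo 0 1))
    (h₂ : MonotoneOn q₂ (Ioo 0 1)) {π : Measure (ℝ × ℝ)} [SFinite π]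
    (hπ₁ : π.map Prod.fst = unif.map q₁) (hπ₂ : π.map Prod.snd = unif.map q₂)
    {p : ℝ} (hp : 1 ≤ p) :
    ∫⁻ z, ENNReal.ofReal (max (z.2 - z.1) 0 ^ p) ∂(quantileCoupling q₁ q₂)
      ≤ ∫⁻ z, ENNReal.ofReal (max (z.2 - z.1) 0 ^ p) ∂π := by
  -- At `p = 1` the weight `p (p - 1) κ ^ (p - 2)` vanishes; the cost is then the single term `κ =
  -- 0`.
  rcases hp.eq_or_lt with rfl | hp
  · have := lintegral_ofReal_sub_sub_le h₁ h₂ hπ₁ hπ₂ 0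
    simpa [ENNReal.ofReal_max] using this
  have key : ∀ m : Measure (ℝ × ℝ), SFinite m →
      ∫⁻ z, ENNReal.ofReal (max (z.2 - z.1) 0 ^ p) ∂m
        = ∫⁻ κ in Ioi (0 : ℝ), ENNReal.ofReal (p * (p - 1) * κ ^ (p - 2))
          * ∫⁻ z, ENNReal.ofReal (z.2 - z.1 - κ) ∂m := by
    intro m hm
    simp_rw [ofReal_max_rpow_eq_lintegral hp]
    rw [lintegral_lintegral_swap]
    · refine lintegral_congr fun κ => ?_
      rw [lintegral_const_mul _ (by fun_prop)]
    · refine Measurable.aemeasurable ?_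
      simp only [Function.uncurry_def]
      fun_prop
  have : SFinite (quantileCoupling q₁ q₂) := by unfold quantileCoupling; infer_instance
  rw [key _ this, key _ inferInstance]
  refine lintegral_mono fun κ => ?_
  refine mul_le_mul_right ?_ _
  exact lintegral_ofReal_sub_sub_le h₁ h₂ hπ₁ hπ₂ κ

theorem lintegral_abs_rpow_eq_add {p : ℝ} (hp : 1 ≤ p) (m : Measure (ℝ × ℝ)) :
    ∫⁻ z, ENNReal.ofReal (|z.1 - z.2| ^ p) ∂m
      = ∫⁻ z, ENNReal.ofReal (max (z.2 - z.1) 0 ^ p) ∂m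
        + ∫⁻ z, ENNReal.ofReal (max (z.2 - z.1) 0 ^ p) ∂(m.map Prod.swap) := by
  have hm : Measurable fun z : ℝ × ℝ => ENNReal.ofReal (max (z.2 - z.1) 0 ^ p) := by fun_prop
  rw [lintegral_map hm measurable_swap, ← lintegral_add_left hm]
  refine lintegral_congr fun z => ?_
  have h0 : (0 : ℝ) ^ p = 0 := Real.zero_rpow (by linarith)
  rcases le_total z.1 z.2 with h | h
  · rw [abs_sub_comm, abs_of_nonneg (by linarith)]
    simp [h, h0]
  · rw [abs_of_nonneg (by linarith)]
    simp [h, h0]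

theorem map_swap_quantileCoupling {q₁ q₂ : ℝ → ℝ} (h₁ : MonotoneOn q₁ (Ioo 0 1))
    (h₂ : MonotoneOn q₂ (Ioo 0 1)) :
    (quantileCoupling q₁ q₂).map Prod.swap = quantileCoupling q₂ q₁ := by
  rw [quantileCoupling, AEMeasurable.map_map_of_aemeasurable measurable_swap.aemeasurable
    ((aemeasurable_unif h₁).prodMk (aemeasurable_unif h₂))]
  rfl

/-- The Wasserstein distance of two measures on the line in terms of quantile functions. -/
theorem wasserstein_map_unif {q₁ q₂ : ℝ → ℝ} (h₁ : MonotoneOn q₁ (Ioo 0 1))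
    (h₂ : MonotoneOn q₂ (Ioo 0 1)) {p : ℝ} (hp : 1 ≤ p) :
    wasserstein p (unif.map q₁) (unif.map q₂)
      = (∫⁻ k, ENNReal.ofReal (|q₁ k - q₂ k| ^ p) ∂unif) ^ (1 / p) := by
  have hq := (aemeasurable_unif h₁).prodMk (aemeasurable_unif h₂)
  have hint : ∫⁻ z, ENNReal.ofReal (|z.1 - z.2| ^ p) ∂(quantileCoupling q₁ q₂)
      = ∫⁻ k, ENNReal.ofReal (|q₁ k - q₂ k| ^ p) ∂unif := by
    rw [quantileCoupling, lintegral_map' (Measurable.aemeasurable (by fun_prop)) hq]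
  rw [← hint]
  refine le_antisymm (iInf₂_le (quantileCoupling q₁ q₂) (show _ ∧ _ ∧ _ from ⟨?_, ?_, ?_⟩))
    (le_iInf₂ ?_)
  · exact Measure.isProbabilityMeasure_map hq
  · rw [quantileCoupling, AEMeasurable.map_map_of_aemeasurable measurable_fst.aemeasurable hq]; rfl
  · rw [quantileCoupling, AEMeasurable.map_map_of_aemeasurable measurable_snd.aemeasurable hq]; rfl
  · rintro π ⟨hπ, hπ₁, hπ₂⟩
    refine ENNReal.rpow_le_rpow ?_ (by positivity)
    rw [lintegral_abs_rpow_eq_add hp, lintegral_abs_rpow_eq_add hp]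
    refine add_le_add (lintegral_max_rpow_le h₁ h₂ hπ₁ hπ₂ hp) ?_
    rw [map_swap_quantileCoupling h₁ h₂]
    refine lintegral_max_rpow_le h₂ h₁ ?_ ?_ hp
    · rw [Measure.map_map measurable_fst measurable_swap, ← hπ₂]; rfl
    · rw [Measure.map_map measurable_snd measurable_swap, ← hπ₁]; rfl

/-! ### Quantile functions of the elements of `𝒰` -/

/-- `q` is a right inverse of `v` on `]0,1[`. -/
def IsQuantile (v q : ℝ → ℝ) : Prop := ∀ k ∈ Ioo (0 : ℝ) 1, v (q k) = k

theorem MemU.mem_Ioo {v : ℝ → ℝ} (h : MemU v) (hs : StrictMono v) (x : ℝ) : v x ∈ Ioo 0 1 :=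
  ⟨(h.mono.le_of_tendsto h.tendsto_atBot (x - 1)).trans_lt (hs (by linarith)),
    (hs (by linarith : x < x + 1)).trans_le (h.mono.ge_of_tendsto h.tendsto_atTop (x + 1))⟩

theorem MemU.exists_isQuantile {v : ℝ → ℝ} (h : MemU v) (hc : Continuous v) :
    ∃ q, IsQuantile v q := by
  have : ∀ k ∈ Ioo (0 : ℝ) 1, ∃ x, v x = k := fun k hk =>
    mem_range_of_exists_le_of_exists_ge hc
      ((h.tendsto_atBot.eventually (eventually_le_nhds hk.1)).exists)
      ((h.tendsto_atTop.eventually (eventually_ge_nhds hk.2)).exists)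
  choose! q hq using this
  exact ⟨q, hq⟩

theorem IsQuantile.le_iff {v q : ℝ → ℝ} (h : IsQuantile v q) (hs : StrictMono v) {k : ℝ}
    (hk : k ∈ Ioo (0 : ℝ) 1) (x : ℝ) : q k ≤ x ↔ k ≤ v x := by
  conv_rhs => rw [← h k hk]
  exact hs.le_iff_le.symm

theorem IsQuantile.monotoneOn {v q : ℝ → ℝ} (h : IsQuantile v q) (hs : StrictMono v) :
    MonotoneOn q (Ioo 0 1) := fun a ha b hb hab => by
  rw [h.le_iff hs ha, h b hb]; exact hab

/-- Distribution functions agree: inside `]0,1[` the set `{q ≤ x}` is `]0, v x]`, where strict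
growth ensures `v x < 1`. -/
theorem IsQuantile.spaceDeriv_eq {v q : ℝ → ℝ} (h : IsQuantile v q) (hv : MemU v)
    (hs : StrictMono v) : spaceDeriv v = unif.map q := by
  have := hv.isProbabilityMeasure
  have hq := aemeasurable_unif (h.monotoneOn hs)
  refine Measure.ext_of_Iic _ _ fun x => ?_
  rw [hv.spaceDeriv_Iic, Measure.map_apply_of_aemeasurable hq measurableSet_Iic, unif,
    Measure.restrict_apply₀' nullMeasurableSet_Ioo]
  have : q ⁻¹' Iic x ∩ Ioo 0 1 = Ioc 0 (v x) := by
    ext k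
    constructor
    · rintro ⟨hk, hk'⟩
      exact ⟨hk'.1, (h.le_iff hs hk' x).1 hk⟩
    · rintro ⟨hk, hk'⟩
      have hk1 : k ∈ Ioo (0 : ℝ) 1 := ⟨hk, hk'.trans_lt (hv.mem_Ioo hs x).2⟩
      exact ⟨(h.le_iff hs hk1 x).2 hk', hk1⟩
  rw [this, Real.volume_Ioc, sub_zero]

theorem ofReal_abs_rpow {p : ℝ} (hp : 1 ≤ p) (x : ℝ) :
    ENNReal.ofReal (|x| ^ p) = ‖x‖ₑ ^ p := by
  rw [← ENNReal.ofReal_rpow_of_nonneg (abs_nonneg _) (by linarith), Real.enorm_eq_ofReal_abs]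

theorem lintegral_abs_rpow_lt_top_iff {p : ℝ} (hp : 1 ≤ p) {q : ℝ → ℝ}
    (hq : AEMeasurable q unif) :
    ∫⁻ k, ENNReal.ofReal (|q k| ^ p) ∂unif < ⊤ ↔ MemLp q (ENNReal.ofReal p) unif := by
  have hp0 : ENNReal.ofReal p ≠ 0 := by simpa using by linarith
  simp_rw [ofReal_abs_rpow hp]
  have := eLpNorm_lt_top_iff_lintegral_rpow_enorm_lt_top (μ := unif) (f := q) hp0
    ENNReal.ofReal_ne_top
  rw [ENNReal.toReal_ofReal (by linarith)] at this
  rw [← this]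
  exact ⟨fun h => ⟨hq.aestronglyMeasurable, h⟩, fun h => h.2⟩

/-- In this form, stability of `𝒰_p` under bounded perturbations of the quantile function is
immediate. -/
theorem IsQuantile.memUp_iff {v q : ℝ → ℝ} (h : IsQuantile v q) (hv : MemU v)
    (hs : StrictMono v) {p : ℝ} (hp : 1 ≤ p) :
    MemUp p v ↔ MemLp q (ENNReal.ofReal p) unif := by
  have hq := aemeasurable_unif (h.monotoneOn hs)
  rw [← lintegral_abs_rpow_lt_top_iff hp hq, MemUp, h.spaceDeriv_eq hv hs,
    lintegral_map' (Measurable.aemeasurable (by fun_prop)) hq]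
  simp [hv]

end ConservationLaw

namespace ConservationLaw

/-! ### The method of characteristics -/

/-- A `C¹` nondecreasing speed `c` and a `C¹` increasing initial datum `u₀ ∈ 𝒰`. -/
structure IsSmoothData (c u₀ : ℝ → ℝ) : Prop where
  speed_contDiff : ContDiff ℝ 1 c
  speed_mono : Monotone c
  contDiff : ContDiff ℝ 1 u₀
  strictMono : StrictMono u₀
  memU : MemU u₀

/-- The position at time `t` of the characteristic issued from `y`. -/
def charMap (c u₀ : ℝ → ℝ) (t y : ℝ) : ℝ := y + t * c (u₀ y)

/-- The foot of the characteristic through `(t, x)`, for `t ≥ 0`. -/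
noncomputable def foot (c u₀ : ℝ → ℝ) (t x : ℝ) : ℝ :=
  -- Negative times are read as `0`, where the map is invertible; this makes `foot` continuous on
  -- the whole plane.
  Function.invFun (charMap c u₀ (max t 0)) x

/-- The function which is constant along characteristics and equal to `u₀` at time `0`. -/
noncomputable def charSol (c u₀ : ℝ → ℝ) (t x : ℝ) : ℝ := u₀ (foot c u₀ t x)

namespace IsSmoothData

variable {c u₀ : ℝ → ℝ}

theorem abs_speed_le (h : IsSmoothData c u₀) (y : ℝ) : |c (u₀ y)| ≤ max |c 0| |c 1| := by
  have h0 := h.memU.mem_Ioo h.strictMono y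
  exact abs_le_max_abs_abs (h.speed_mono h0.1.le) (h.speed_mono h0.2.le)

/-- This is the absence of shocks: faster characteristics start further to the right. -/
theorem charMap_strictMono (h : IsSmoothData c u₀) {t : ℝ} (ht : 0 ≤ t) :
    StrictMono (charMap c u₀ t) := fun _ _ hab =>
  add_lt_add_of_lt_of_le hab
    (mul_le_mul_of_nonneg_left (h.speed_mono (h.strictMono hab).le) ht)

theorem charMap_continuous (h : IsSmoothData c u₀) : Continuous fun z : ℝ × ℝ =>
    charMap c u₀ z.1 z.2 := by
  have h1 := h.speed_contDiff.continuous
  have h2 := h.contDiff.continuous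
  unfold charMap
  fun_prop

theorem abs_charMap_sub_le (h : IsSmoothData c u₀) {t : ℝ} (ht : 0 ≤ t) (y : ℝ) :
    |charMap c u₀ t y - y| ≤ t * max |c 0| |c 1| := by
  rw [charMap, add_sub_cancel_left, abs_mul, abs_of_nonneg ht]
  exact mul_le_mul_of_nonneg_left (h.abs_speed_le y) ht

theorem charMap_surjective (h : IsSmoothData c u₀) {t : ℝ} (ht : 0 ≤ t) :
    Function.Surjective (charMap c u₀ t) := by
  have hc : Continuous (charMap c u₀ t) := h.charMap_continuous.comp (Continuous.prodMk_right t)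
  refine hc.surjective ?_ ?_
  · refine tendsto_atTop_mono (f := fun y => y + -(t * max |c 0| |c 1|)) (fun y => ?_)
      (tendsto_atTop_add_const_right _ _ tendsto_id)
    linarith [neg_le_of_abs_le (h.abs_charMap_sub_le ht y)]
  · refine tendsto_atBot_mono (f := fun y => y + t * max |c 0| |c 1|) (fun y => ?_)
      (tendsto_atBot_add_const_right _ _ tendsto_id)
    linarith [le_of_abs_le (h.abs_charMap_sub_le ht y)]

theorem charMap_foot (h : IsSmoothData c u₀) {t : ℝ} (ht : 0 ≤ t) (x : ℝ) :
    charMap c u₀ t (foot c u₀ t x) = x := by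
  rw [foot, max_eq_left ht]
  exact Function.invFun_eq (h.charMap_surjective ht x)

theorem foot_charMap (h : IsSmoothData c u₀) {t : ℝ} (ht : 0 ≤ t) (y : ℝ) :
    foot c u₀ t (charMap c u₀ t y) = y :=
  (h.charMap_strictMono ht).injective (h.charMap_foot ht _)

theorem foot_zero (h : IsSmoothData c u₀) (x : ℝ) : foot c u₀ 0 x = x := by
  have := h.foot_charMap le_rfl x
  simpa [charMap] using this

theorem charSol_zero (h : IsSmoothData c u₀) : charSol c u₀ 0 = u₀ := by
  ext x; rw [charSol, h.foot_zero]

theorem foot_strictMono (h : IsSmoothData c u₀) {t : ℝ} (ht : 0 ≤ t) :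
    StrictMono (foot c u₀ t) := fun a b hab => by
  rw [← (h.charMap_strictMono ht).lt_iff_lt, h.charMap_foot ht, h.charMap_foot ht]
  exact hab

theorem foot_max (t x : ℝ) : foot c u₀ (max t 0) x = foot c u₀ t x := by
  simp [foot]

/-- At fixed time the characteristic map expands distances, so its inverse is 1-Lipschitz; changing
the time moves points at most at the maximal speed. -/
theorem abs_foot_sub_foot_le (h : IsSmoothData c u₀) (t s x y : ℝ) :
    |foot c u₀ t x - foot c u₀ s y| ≤ |x - y| + |max t 0 - max s 0| * max |c 0| |c 1| := by
  have ht : 0 ≤ max t 0 := le_max_right _ _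
  have h1 := h.charMap_foot ht x
  have h2 := h.charMap_foot (le_max_right s 0) y
  rw [foot_max, charMap] at h1 h2
  set a := foot c u₀ t x
  set b := foot c u₀ s y
  -- Expansion: `a - b` and `c (u₀ a) - c (u₀ b)` have the same sign.
  have hle : |a - b| ≤ |(a - b) + max t 0 * (c (u₀ a) - c (u₀ b))| := by
    rcases le_total b a with hab | hab
    · have := mul_nonneg ht (sub_nonneg.2 (h.speed_mono (h.strictMono.monotone hab)))
      rw [abs_of_nonneg (sub_nonneg.2 hab)]
      exact (by linarith : a - b ≤ _).trans (le_abs_self _)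
    · have := mul_nonneg ht (sub_nonneg.2 (h.speed_mono (h.strictMono.monotone hab)))
      rw [abs_of_nonpos (sub_nonpos.2 hab)]
      exact (by linarith : -(a - b) ≤ -_).trans (neg_le_abs _)
  have e : (a - b) + max t 0 * (c (u₀ a) - c (u₀ b))
      = (x - y) - (max t 0 - max s 0) * c (u₀ b) := by linear_combination h1 - h2
  rw [e] at hle
  refine hle.trans ((abs_sub _ _).trans ?_)
  rw [abs_mul]
  gcongr
  exact h.abs_speed_le b

theorem foot_continuous (h : IsSmoothData c u₀) :
    Continuous fun z : ℝ × ℝ => foot c u₀ z.1 z.2 := by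
  rw [continuous_iff_continuousAt]
  intro z
  rw [ContinuousAt, tendsto_iff_dist_tendsto_zero]
  refine squeeze_zero (fun _ => dist_nonneg)
    (fun w => h.abs_foot_sub_foot_le w.1 z.1 w.2 z.2) ?_
  have : Continuous fun w : ℝ × ℝ =>
    |w.2 - z.2| + |max w.1 0 - max z.1 0| * max |c 0| |c 1| := by fun_prop
  simpa using this.tendsto z

theorem charSol_continuous (h : IsSmoothData c u₀) :
    Continuous fun z : ℝ × ℝ => charSol c u₀ z.1 z.2 :=
  h.contDiff.continuous.comp h.foot_continuous

theorem charSol_charMap (h : IsSmoothData c u₀) {t : ℝ} (ht : 0 ≤ t) (y : ℝ) :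
    charSol c u₀ t (charMap c u₀ t y) = u₀ y := by
  rw [charSol, h.foot_charMap ht]

theorem charSol_mem_Ioo (h : IsSmoothData c u₀) (t x : ℝ) : charSol c u₀ t x ∈ Ioo 0 1 :=
  h.memU.mem_Ioo h.strictMono _

theorem charSol_strictMono (h : IsSmoothData c u₀) {t : ℝ} (ht : 0 ≤ t) :
    StrictMono (charSol c u₀ t) := h.strictMono.comp (h.foot_strictMono ht)

theorem charSol_memU (h : IsSmoothData c u₀) {t : ℝ} (ht : 0 ≤ t) :
    MemU (charSol c u₀ t) where
  mono := (h.charSol_strictMono ht).monotone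
  rightCont x := (h.charSol_continuous.comp
    (Continuous.prodMk_right t)).continuousAt.continuousWithinAt
  tendsto_atBot := by
    refine h.memU.tendsto_atBot.comp ?_
    refine tendsto_atBot_mono (f := fun y => y + t * max |c 0| |c 1|) (fun x => ?_)
      (tendsto_atBot_add_const_right _ _ tendsto_id)
    have := h.abs_charMap_sub_le ht (foot c u₀ t x)
    rw [h.charMap_foot ht] at this
    linarith [neg_le_of_abs_le this]
  tendsto_atTop := by
    refine h.memU.tendsto_atTop.comp ?_
    refine tendsto_atTop_mono (f := fun y => y + -(t * max |c 0| |c 1|)) (fun x => ?_)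
      (tendsto_atTop_add_const_right _ _ tendsto_id)
    have := h.abs_charMap_sub_le ht (foot c u₀ t x)
    rw [h.charMap_foot ht] at this
    linarith [le_of_abs_le this]

/-- The displacement `t * c k` does not involve the datum; the conservation of `W_p` comes from
this. -/
theorem isQuantile_charSol (h : IsSmoothData c u₀) {q : ℝ → ℝ} (hq : IsQuantile u₀ q) {t : ℝ}
    (ht : 0 ≤ t) : IsQuantile (charSol c u₀ t) (fun k => q k + t * c k) := by
  intro k hk
  have := h.charSol_charMap ht (q k)
  rwa [charMap, hq k hk] at this

/-- The level sets of the solution are straight lines. -/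
theorem lt_charSol_iff (h : IsSmoothData c u₀) {q : ℝ → ℝ} (hq : IsQuantile u₀ q) {t : ℝ}
    (ht : 0 ≤ t) {k : ℝ} (hk : k ∈ Ioo (0 : ℝ) 1) (x : ℝ) :
    k < charSol c u₀ t x ↔ q k + t * c k < x := by
  conv_lhs => rw [← h.isQuantile_charSol hq ht k hk]
  exact (h.charSol_strictMono ht).lt_iff_lt

theorem charSol_lt_iff (h : IsSmoothData c u₀) {q : ℝ → ℝ} (hq : IsQuantile u₀ q) {t : ℝ}
    (ht : 0 ≤ t) {k : ℝ} (hk : k ∈ Ioo (0 : ℝ) 1) (x : ℝ) :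
    charSol c u₀ t x < k ↔ x < q k + t * c k := by
  conv_lhs => rw [← h.isQuantile_charSol hq ht k hk]
  exact (h.charSol_strictMono ht).lt_iff_lt

/-- The map `(t, y) ↦ (t, charMap t y)` for `t > 0`. -/
noncomputable def charHomeomorph (h : IsSmoothData c u₀) :
    OpenPartialHomeomorph (ℝ × ℝ) (ℝ × ℝ) where
  toFun z := (z.1, charMap c u₀ z.1 z.2)
  invFun z := (z.1, foot c u₀ z.1 z.2)
  source := Ioi 0 ×ˢ univ
  target := Ioi 0 ×ˢ univ
  map_source' _ hz := hz
  map_target' _ hz := hz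
  left_inv' z hz := Prod.ext rfl (h.foot_charMap (le_of_lt hz.1) z.2)
  right_inv' z hz := Prod.ext rfl (h.charMap_foot (le_of_lt hz.1) z.2)
  open_source := isOpen_Ioi.prod isOpen_univ
  open_target := isOpen_Ioi.prod isOpen_univ
  continuousOn_toFun := (continuous_fst.prodMk h.charMap_continuous).continuousOn
  continuousOn_invFun := (continuous_fst.prodMk h.foot_continuous).continuousOn

end IsSmoothData

/-! ### Regularity of the characteristic solution and the pointwise equation -/

/-- The linear automorphism `(s, y) ↦ (s, a s + b y)` of the plane. -/
noncomputable def shearEquiv (a : ℝ) {b : ℝ} (hb : b ≠ 0) : (ℝ × ℝ) ≃L[ℝ] (ℝ × ℝ) :=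
  ContinuousLinearEquiv.equivOfInverse
    ((ContinuousLinearMap.fst ℝ ℝ ℝ).prod
      (a • ContinuousLinearMap.fst ℝ ℝ ℝ + b • ContinuousLinearMap.snd ℝ ℝ ℝ))
    ((ContinuousLinearMap.fst ℝ ℝ ℝ).prod
      (b⁻¹ • ContinuousLinearMap.snd ℝ ℝ ℝ - (b⁻¹ * a) • ContinuousLinearMap.fst ℝ ℝ ℝ))
    (fun z => by ext <;> simp; field_simp; ring)
    (fun z => by ext <;> simp; field_simp; ring)

namespace IsSmoothData

variable {c u₀ : ℝ → ℝ}

/-- Inverse function theorem for `(t, y) ↦ (t, charMap t y)`: its differential is a shear with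
coefficient `1 + t (c ∘ u₀)'`, positive because `c ∘ u₀` is nondecreasing. -/
theorem foot_contDiffAt (h : IsSmoothData c u₀) {z : ℝ × ℝ} (hz : 0 < z.1) :
    ContDiffAt ℝ 1 (fun z : ℝ × ℝ => foot c u₀ z.1 z.2) z := by
  set y := foot c u₀ z.1 z.2
  have hcu : ContDiff ℝ 1 (fun y => c (u₀ y)) := h.speed_contDiff.comp h.contDiff
  have hd : HasDerivAt (fun y => c (u₀ y)) (deriv (fun y => c (u₀ y)) y) y :=
    (hcu.differentiable one_ne_zero y).hasDerivAt
  have hnonneg : 0 ≤ deriv (fun y => c (u₀ y)) y :=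
    (h.speed_mono.comp h.strictMono.monotone).deriv_nonneg
  have hb : 1 + z.1 * deriv (fun y => c (u₀ y)) y ≠ 0 := by positivity
  have hsm : ContDiff ℝ 1 (fun z : ℝ × ℝ => (z.1, charMap c u₀ z.1 z.2)) :=
    contDiff_fst.prodMk
      (contDiff_snd.add (contDiff_fst.mul (hcu.comp contDiff_snd)))
  have hfd : HasFDerivAt (fun z : ℝ × ℝ => (z.1, charMap c u₀ z.1 z.2))
      (shearEquiv (c (u₀ y)) hb : (ℝ × ℝ) →L[ℝ] (ℝ × ℝ)) (z.1, y) := by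
    have h2 : HasFDerivAt (fun z : ℝ × ℝ => c (u₀ z.2))
        (deriv (fun y => c (u₀ y)) y • ContinuousLinearMap.snd ℝ ℝ ℝ) (z.1, y) :=
      HasDerivAt.comp_hasFDerivAt (z.1, y) (f := Prod.snd) hd hasFDerivAt_snd
    have := (hasFDerivAt_fst (𝕜 := ℝ) (p := (z.1, y))).prodMk
      ((hasFDerivAt_snd (𝕜 := ℝ) (p := (z.1, y))).add
        ((hasFDerivAt_fst (𝕜 := ℝ) (p := (z.1, y))).mul h2))
    refine this.congr_fderiv ?_
    ext <;> simp [shearEquiv]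
  have := h.charHomeomorph.contDiffAt_symm (n := 1) (a := z) ⟨hz, mem_univ _⟩
    (f₀' := shearEquiv (c (u₀ y)) hb) hfd hsm.contDiffAt
  exact contDiffAt_snd.comp z this

theorem charSol_contDiffAt (h : IsSmoothData c u₀) {z : ℝ × ℝ} (hz : 0 < z.1) :
    ContDiffAt ℝ 1 (fun z : ℝ × ℝ => charSol c u₀ z.1 z.2) z :=
  h.contDiff.contDiffAt.comp z (h.foot_contDiffAt hz)

end IsSmoothData

theorem isSmoothData_deriv {f u₀ : ℝ → ℝ} (hf : ContDiff ℝ 2 f) (hfc : ConvexOn ℝ univ f)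
    (hu : ContDiff ℝ 1 u₀) (hs : StrictMono u₀) (hU : MemU u₀) :
    IsSmoothData (deriv f) u₀ where
  speed_contDiff := hf.deriv'
  speed_mono := monotoneOn_univ.1 <|
    hfc.monotoneOn_deriv fun x _ => hf.differentiable two_ne_zero x
  contDiff := hu
  strictMono := hs
  memU := hU

/-- The derivative of `u` along a characteristic is `u_t + f'(u) u_x` by the chain rule, and `0`
because `u` is constant there. -/
theorem IsSmoothData.isClassicalSolution {f u₀ : ℝ → ℝ} (h : IsSmoothData (deriv f) u₀)
    (hf : Differentiable ℝ f) : IsClassicalSolution f u₀ (charSol (deriv f) u₀) where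
  contDiffOn z hz := (h.charSol_contDiffAt hz.1).contDiffWithinAt
  continuousOn := h.charSol_continuous.continuousOn
  initial x := by rw [h.charSol_zero]
  equation t x ht := by
    set u := charSol (deriv f) u₀
    have hL := ((h.charSol_contDiffAt (z := (t, x)) ht).differentiableAt one_ne_zero).hasFDerivAt
    set L := fderiv ℝ (fun z : ℝ × ℝ => u z.1 z.2) (t, x)
    have d1 : HasDerivAt (fun s => u s x) (L (1, 0)) t :=
      hL.comp_hasDerivAt (f := fun s => (s, x)) t ((hasDerivAt_id t).prodMk (hasDerivAt_const t x))
    have d2 : HasDerivAt (fun y => u t y) (L (0, 1)) x :=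
      hL.comp_hasDerivAt (f := fun y => (t, y)) x ((hasDerivAt_const x t).prodMk (hasDerivAt_id x))
    have d3 : HasDerivAt (fun y => f (u t y)) (deriv f (u t x) * L (0, 1)) x :=
      (hf (u t x)).hasDerivAt.comp x d2
    have hfoot := h.charMap_foot ht.le x
    set y := foot (deriv f) u₀ t x
    have hux : u t x = u₀ y := rfl
    have d4 : HasDerivAt (fun s => u s (charMap (deriv f) u₀ s y)) (L (1, deriv f (u₀ y))) t := by
      have hcurve : HasDerivAt (fun s => (s, charMap (deriv f) u₀ s y)) (1, deriv f (u₀ y)) t := by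
        refine (hasDerivAt_id t).prodMk ?_
        have := ((hasDerivAt_id t).mul_const (deriv f (u₀ y))).const_add y
        rw [one_mul] at this
        exact this
      refine HasFDerivAt.comp_hasDerivAt (l := fun z : ℝ × ℝ => u z.1 z.2) t ?_ hcurve
      rw [hfoot]; exact hL
    have d5 : HasDerivAt (fun s => u s (charMap (deriv f) u₀ s y)) 0 t := by
      refine (hasDerivAt_const t (u₀ y)).congr_of_eventuallyEq ?_
      filter_upwards [lt_mem_nhds ht] with s hs
      exact h.charSol_charMap hs.le y
    have e := d4.unique d5
    have e2 : ((1, deriv f (u₀ y)) : ℝ × ℝ) = (1, 0) + deriv f (u₀ y) • (0, 1) := by simp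
    rw [e2, map_add, map_smul, smul_eq_mul] at e
    rw [d1.deriv, d3.deriv, hux, e]

end ConservationLaw

namespace ConservationLaw

/-! ### The entropy inequality for the solution given by characteristics -/

/-- Lebesgue measure on the half-plane `t > 0`. -/
noncomputable def halfPlane : Measure (ℝ × ℝ) := volume.restrict (Ioi 0 ×ˢ univ)

theorem halfPlane_eq_prod : halfPlane = ((volume : Measure ℝ).restrict (Ioi 0)).prod volume := by
  rw [halfPlane, Measure.volume_eq_prod, ← Measure.prod_restrict, Measure.restrict_univ]

instance : SFinite halfPlane := by unfold halfPlane; infer_instance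

theorem isClosedEmbedding_mk_left (x : ℝ) : IsClosedEmbedding fun t : ℝ => (t, x) :=
  (Isometry.of_dist_eq fun a b => by simp [Prod.dist_eq]).isClosedEmbedding

theorem isClosedEmbedding_mk_right (t : ℝ) : IsClosedEmbedding fun x : ℝ => (t, x) :=
  (Isometry.of_dist_eq fun a b => by simp [Prod.dist_eq]).isClosedEmbedding

theorem integrable_fderiv_apply {φ : ℝ × ℝ → ℝ} (hφ : ContDiff ℝ 1 φ) (hc : HasCompactSupport φ)
    (v : ℝ × ℝ) : Integrable (fun z => fderiv ℝ φ z v) halfPlane :=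
  (((hφ.continuous_fderiv one_ne_zero).clm_apply continuous_const).integrable_of_hasCompactSupport
    (hc.fderiv_apply ℝ v)).integrableOn

theorem abs_indicator_one_le (A : Set ℝ) (x : ℝ) : ‖A.indicator (1 : ℝ → ℝ) x‖ ≤ 1 := by
  by_cases h : x ∈ A <;> simp [h]

/-- The indicator does not depend on time, so integrating in `t` on each vertical line leaves only
the boundary term at `t = 0`. -/
theorem integral_halfPlane_deriv_fst {ψ : ℝ × ℝ → ℝ} (hψ : ContDiff ℝ 1 ψ)
    (hc : HasCompactSupport ψ) {A : Set ℝ} (hA : MeasurableSet A) :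
    ∫ z, A.indicator (1 : ℝ → ℝ) z.2 * fderiv ℝ ψ z (1, 0) ∂halfPlane
      = - ∫ x, A.indicator (1 : ℝ → ℝ) x * ψ (0, x) := by
  have hint : Integrable (fun z : ℝ × ℝ => A.indicator (1 : ℝ → ℝ) z.2 * fderiv ℝ ψ z (1, 0))
      halfPlane := (integrable_fderiv_apply hψ hc (1, 0)).bdd_mul
        (((measurable_one.indicator hA).comp measurable_snd).aestronglyMeasurable)
        (Eventually.of_forall fun z => abs_indicator_one_le A z.2)
  rw [halfPlane_eq_prod] at hint ⊢
  rw [integral_prod_symm _ hint, ← integral_neg]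
  refine integral_congr_ae (Eventually.of_forall fun x => ?_)
  have hd : ∀ t, fderiv ℝ ψ (t, x) (1, 0) = deriv (fun s => ψ (s, x)) t := fun t =>
    ((hψ.differentiable one_ne_zero (t, x)).hasFDerivAt.comp_hasDerivAt (f := fun s => (s, x)) t
      ((hasDerivAt_id t).prodMk (hasDerivAt_const t x))).deriv.symm
  simp only [hd]
  rw [integral_const_mul, HasCompactSupport.integral_Ioi_deriv_eq
    (f := fun s => ψ (s, x)) (hψ.comp (contDiff_id.prodMk contDiff_const)) (hc.comp_isClosedEmbedding
      (isClosedEmbedding_mk_left x)) 0, mul_neg]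

/-- The shear `x ↦ x + a t` straightens the lines of slope `a` and turns `∂_t + a ∂_x` into `∂_t`,
without changing area. -/
theorem integral_halfPlane_deriv_line {φ : ℝ × ℝ → ℝ} (hφ : ContDiff ℝ 1 φ)
    (hc : HasCompactSupport φ) (a : ℝ) {A : Set ℝ} (hA : MeasurableSet A) :
    ∫ z, A.indicator (1 : ℝ → ℝ) (z.2 - a * z.1)
        * (fderiv ℝ φ z (1, 0) + a * fderiv ℝ φ z (0, 1)) ∂halfPlane
      = - ∫ x, A.indicator (1 : ℝ → ℝ) x * φ (0, x) := by
  set S := shearEquiv a (one_ne_zero (α := ℝ))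
  have hS : ∀ z, S z = (z.1, a * z.1 + z.2) := fun z => by ext <;> simp [S, shearEquiv]
  have hψ : ContDiff ℝ 1 (φ ∘ S) := hφ.comp S.contDiff
  have hψc : HasCompactSupport (φ ∘ S) := hc.comp_homeomorph S.toHomeomorph
  have e := integral_halfPlane_deriv_fst hψ hψc hA
  have hfd : ∀ z, fderiv ℝ (φ ∘ S) z (1, 0)
      = fderiv ℝ φ (S z) (1, 0) + a * fderiv ℝ φ (S z) (0, 1) := by
    intro z
    rw [S.comp_right_fderiv]
    have : S (1, 0) = (1, 0) + a • (0, 1) := by rw [hS]; simp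
    simp only [ContinuousLinearMap.comp_apply, ContinuousLinearEquiv.coe_coe, this, map_add,
      map_smul, smul_eq_mul]
  have hi1 : Integrable (fun z : ℝ × ℝ => A.indicator (1 : ℝ → ℝ) z.2
      * fderiv ℝ (φ ∘ S) z (1, 0)) halfPlane := (integrable_fderiv_apply hψ hψc (1, 0)).bdd_mul
        (((measurable_one.indicator hA).comp measurable_snd).aestronglyMeasurable)
        (Eventually.of_forall fun z => abs_indicator_one_le A z.2)
  have hi2 : Integrable (fun z : ℝ × ℝ => A.indicator (1 : ℝ → ℝ) (z.2 - a * z.1)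
        * (fderiv ℝ φ z (1, 0) + a * fderiv ℝ φ z (0, 1))) halfPlane := by
    refine ((integrable_fderiv_apply hφ hc (1, 0)).add
      ((integrable_fderiv_apply hφ hc (0, 1)).const_mul a)).bdd_mul (c := 1) ?_
        (Eventually.of_forall fun z => abs_indicator_one_le A _)
    exact ((measurable_one.indicator hA).comp (by fun_prop : Measurable fun z : ℝ × ℝ =>
      z.2 - a * z.1)).aestronglyMeasurable
  have e0 : ∀ x, (φ ∘ S) (0, x) = φ (0, x) := fun x => by simp [hS]
  simp only [e0] at e
  rw [← e]
  rw [halfPlane_eq_prod] at hi1 hi2 ⊢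
  rw [integral_prod _ hi1, integral_prod _ hi2]
  refine integral_congr_ae (Eventually.of_forall fun t => ?_)
  simp only
  rw [← integral_add_right_eq_self _ (a * t)]
  refine integral_congr_ae (Eventually.of_forall fun x => ?_)
  simp only [hfd, hS, add_sub_cancel_right, add_comm (a * t) x]

/-- Layer cake formula on `]0,1[`. -/
theorem integral_unif_indicator {w : ℝ} (hw : w ∈ Ioo (0 : ℝ) 1) (g : ℝ → ℝ) :
    ∫ k, (Iio w).indicator 1 k * g k ∂unif = ∫ k in (0 : ℝ)..w, g k := by
  have : (fun k => (Iio w).indicator 1 k * g k) = (Iio w).indicator g := by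
    ext k; by_cases h : k < w <;> simp [h]
  rw [this, unif, integral_indicator measurableSet_Iio, Measure.restrict_restrict measurableSet_Iio,
    intervalIntegral.integral_of_le hw.1.le, integral_Ioc_eq_integral_Ioo]
  congr 2
  ext k
  simp only [mem_inter_iff, mem_Iio, mem_Ioo]
  exact ⟨fun h => ⟨h.2.1, h.1⟩, fun h => ⟨h.2, h.1, h.2.trans hw.2⟩⟩

theorem LipschitzWith.integral_deriv_eq {E : ℝ → ℝ} {K : ℝ≥0} (hE : LipschitzWith K E) (w : ℝ) :
    ∫ k in (0 : ℝ)..w, deriv E k = E w - E 0 :=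
  (hE.lipschitzOnWith.absolutelyContinuousOnInterval).integral_deriv_eq_sub

theorem integrable_unif_of_bound {g : ℝ → ℝ} (hg : Measurable g) {C : ℝ}
    (hb : ∀ k ∈ Ioo (0 : ℝ) 1, |g k| ≤ C) : Integrable g unif :=
  Integrable.of_bound hg.aestronglyMeasurable C
    ((ae_restrict_iff' measurableSet_Ioo).2 (Eventually.of_forall hb))

theorem Integrable.indicator_one_mul {g : ℝ → ℝ} (hg : Integrable g unif) (w : ℝ) :
    Integrable (fun k => (Iio w).indicator 1 k * g k) unif :=
  hg.bdd_mul (measurable_one.indicator measurableSet_Iio).aestronglyMeasurable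
    (Eventually.of_forall fun k => abs_indicator_one_le _ k)

/-- The entropy equality satisfied by the solution given by characteristics. -/
theorem IsSmoothData.entropy_eq {f u₀ : ℝ → ℝ} (h : IsSmoothData (deriv f) u₀) {E : ℝ → ℝ}
    {K : ℝ≥0} (hE : LipschitzWith K E) {φ : ℝ × ℝ → ℝ} (hφ : ContDiff ℝ 1 φ)
    (hc : HasCompactSupport φ) :
    ∫ z, (E (charSol (deriv f) u₀ z.1 z.2) * fderiv ℝ φ z (1, 0)
        + entropyFlux f E (charSol (deriv f) u₀ z.1 z.2) * fderiv ℝ φ z (0, 1)) ∂halfPlane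
      = - ∫ x, E (u₀ x) * φ (0, x) := by
  obtain ⟨q, hq⟩ := h.memU.exists_isQuantile h.contDiff.continuous
  set u := charSol (deriv f) u₀
  set c := deriv f
  set g := deriv E
  set M := max |c 0| |c 1|
  have hgm : Measurable g := measurable_deriv E
  have hcm : Measurable c := h.speed_contDiff.continuous.measurable
  have hgb : ∀ k, |g k| ≤ K := fun k => norm_deriv_le_of_lipschitz hE
  have hcb : ∀ k ∈ Ioo (0 : ℝ) 1, |c k| ≤ M := fun k hk =>
    abs_le_max_abs_abs (h.speed_mono hk.1.le) (h.speed_mono hk.2.le)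
  have hgi : Integrable g unif := integrable_unif_of_bound hgm fun k _ => hgb k
  have hcgi : Integrable (fun k => c k * g k) unif := by
    refine integrable_unif_of_bound (hcm.mul hgm) (C := M * K) fun k hk => ?_
    rw [abs_mul]
    gcongr
    exacts [hcb k hk, hgb k]
  have hEw : ∀ w ∈ Ioo (0 : ℝ) 1, E w = E 0 + ∫ k, (Iio w).indicator 1 k * g k ∂unif := by
    intro w hw
    rw [integral_unif_indicator hw, LipschitzWith.integral_deriv_eq hE]; ring
  have hFw : ∀ w ∈ Ioo (0 : ℝ) 1, entropyFlux f E w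
      = ∫ k, (Iio w).indicator 1 k * (c k * g k) ∂unif := by
    intro w hw
    rw [integral_unif_indicator hw]; rfl
  have hφ1 := integrable_fderiv_apply hφ hc (1, 0)
  have hφ2 := integrable_fderiv_apply hφ hc (0, 1)
  have hmeas : MeasurableSet {y : (ℝ × ℝ) × ℝ | y.2 < u y.1.1 y.1.2} :=
    measurableSet_lt measurable_snd (h.charSol_continuous.measurable.comp measurable_fst)
  have hI : ∀ᵐ k ∂unif, k ∈ Ioo (0 : ℝ) 1 := ae_restrict_mem measurableSet_Ioo
  have hIz : ∀ᵐ y ∂(halfPlane.prod unif), y.2 ∈ Ioo (0 : ℝ) 1 :=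
    Measure.quasiMeasurePreserving_snd.ae hI
  -- the integrand as a function of `(t, x)` and of the level `k`
  have hΦ : Integrable (fun y : (ℝ × ℝ) × ℝ => (Iio (u y.1.1 y.1.2)).indicator (1 : ℝ → ℝ) y.2
      * g y.2 * (fderiv ℝ φ y.1 (1, 0) + c y.2 * fderiv ℝ φ y.1 (0, 1)))
      (halfPlane.prod unif) := by
    have hdom : Integrable (fun y : (ℝ × ℝ) × ℝ => (K : ℝ) * (‖fderiv ℝ φ y.1 (1, 0)‖
        + M * ‖fderiv ℝ φ y.1 (0, 1)‖)) (halfPlane.prod unif) :=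
      ((hφ1.norm.add (hφ2.norm.const_mul M)).const_mul (K : ℝ)).comp_fst unif
    refine hdom.mono' ?_ ?_
    · have m1 : Measurable fun y : (ℝ × ℝ) × ℝ =>
          (Iio (u y.1.1 y.1.2)).indicator (1 : ℝ → ℝ) y.2 :=
        measurable_one.indicator hmeas
      have m2 : ∀ v, Measurable fun y : (ℝ × ℝ) × ℝ => fderiv ℝ φ y.1 v := fun v =>
        (((hφ.continuous_fderiv one_ne_zero).clm_apply continuous_const).measurable).comp
          measurable_fst
      exact ((m1.mul (hgm.comp measurable_snd)).mul ((m2 _).add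
        ((hcm.comp measurable_snd).mul (m2 _)))).aestronglyMeasurable
    · filter_upwards [hIz] with y hy
      rw [norm_mul, norm_mul]
      have b1 := abs_indicator_one_le (Iio (u y.1.1 y.1.2)) y.2
      have b2 : ‖g y.2‖ ≤ K := hgb _
      have b3 : ‖c y.2‖ ≤ M := hcb _ hy
      have b4 : ‖fderiv ℝ φ y.1 (1, 0) + c y.2 * fderiv ℝ φ y.1 (0, 1)‖
          ≤ ‖fderiv ℝ φ y.1 (1, 0)‖ + M * ‖fderiv ℝ φ y.1 (0, 1)‖ := by
        refine (norm_add_le _ _).trans ?_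
        rw [norm_mul]
        gcongr
      have : ‖(Iio (u y.1.1 y.1.2)).indicator (1 : ℝ → ℝ) y.2‖ * ‖g y.2‖ ≤ 1 * K := by gcongr
      rw [one_mul] at this
      gcongr
  -- The nonlinear integrand becomes a superposition over `k` of linear transport terms with
  -- constant speed `c k`.
  have hpt : ∀ z : ℝ × ℝ, E (u z.1 z.2) * fderiv ℝ φ z (1, 0)
        + entropyFlux f E (u z.1 z.2) * fderiv ℝ φ z (0, 1)
      = E 0 * fderiv ℝ φ z (1, 0) + ∫ k, (Iio (u z.1 z.2)).indicator (1 : ℝ → ℝ) k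
      * g k * (fderiv ℝ φ z (1, 0) + c k * fderiv ℝ φ z (0, 1)) ∂unif := by
    intro z
    have hz := h.charSol_mem_Ioo z.1 z.2
    rw [hEw _ hz, hFw _ hz, add_mul, add_assoc, ← integral_mul_const, ← integral_mul_const,
      ← integral_add]
    · congr 1
      refine integral_congr_ae (Eventually.of_forall fun k => ?_)
      simp only; ring
    · exact (Integrable.indicator_one_mul hgi _).mul_const _
    · exact (Integrable.indicator_one_mul hcgi _).mul_const _
  have hφ0 : Integrable (fun x => φ (0, x)) :=
    (hφ.continuous.comp (Continuous.prodMk_right 0)).integrable_of_hasCompactSupport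
      (hc.comp_isClosedEmbedding (isClosedEmbedding_mk_right 0))
  have hu₀ : Integrable (fun y : ℝ × ℝ => (Iio (u₀ y.1)).indicator (1 : ℝ → ℝ) y.2 * g y.2
      * φ (0, y.1)) (volume.prod unif) := by
    have hm0 : MeasurableSet {y : ℝ × ℝ | y.2 < u₀ y.1} :=
      measurableSet_lt measurable_snd (h.contDiff.continuous.measurable.comp measurable_fst)
    have m1 : Measurable fun y : ℝ × ℝ => (Iio (u₀ y.1)).indicator (1 : ℝ → ℝ) y.2 :=
      measurable_one.indicator hm0
    refine (hφ0.comp_fst unif).bdd_mul (c := K)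
      (m1.mul (hgm.comp measurable_snd)).aestronglyMeasurable (Eventually.of_forall fun y => ?_)
    rw [norm_mul]
    have b1 := abs_indicator_one_le (Iio (u₀ y.1)) y.2
    have b2 : ‖g y.2‖ ≤ K := hgb _
    have : ‖(Iio (u₀ y.1)).indicator (1 : ℝ → ℝ) y.2‖ * ‖g y.2‖ ≤ 1 * K := by gcongr
    rwa [one_mul] at this
  have hmass : ∫ z, fderiv ℝ φ z (1, 0) ∂halfPlane = - ∫ x, φ (0, x) := by
    simpa using integral_halfPlane_deriv_fst hφ hc MeasurableSet.univ
  -- For `t > 0`, `{u > k}` is the region to the right of `x = q k + c k * t`, so each level falls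
  -- under `integral_halfPlane_deriv_line`.
  have hline : ∀ k ∈ Ioo (0 : ℝ) 1,
      ∫ z, (Iio (u z.1 z.2)).indicator (1 : ℝ → ℝ) k * g k
        * (fderiv ℝ φ z (1, 0) + c k * fderiv ℝ φ z (0, 1)) ∂halfPlane
      = - ∫ x, (Iio (u₀ x)).indicator (1 : ℝ → ℝ) k * g k * φ (0, x) := by
    intro k hk
    have e1 : ∀ x, (Iio (u₀ x)).indicator (1 : ℝ → ℝ) k = (Ioi (q k)).indicator (1 : ℝ → ℝ) x := by
      intro x
      have : k < u₀ x ↔ q k < x := by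
        rw [← not_le, ← not_le]
        constructor
        · intro h1 h2; exact h1 ((h.strictMono.monotone h2).trans_eq (hq k hk))
        · intro h1 h2; exact h1 ((h.strictMono.le_iff_le).1 (h2.trans_eq (hq k hk).symm))
      simp [indicator, this]
    have e2 : ∀ᵐ z ∂halfPlane, (Iio (u z.1 z.2)).indicator (1 : ℝ → ℝ) k
        = (Ioi (q k)).indicator (1 : ℝ → ℝ) (z.2 - c k * z.1) := by
      refine (ae_restrict_iff' (measurableSet_Ioi.prod MeasurableSet.univ)).2
        (Eventually.of_forall fun z hz => ?_)
      have := h.lt_charSol_iff hq (le_of_lt hz.1) hk z.2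
      have : k < u z.1 z.2 ↔ q k < z.2 - c k * z.1 := by rw [this, lt_sub_iff_add_lt, mul_comm]
      simp [indicator, this]
    have e3 := integral_halfPlane_deriv_line hφ hc (c k) (measurableSet_Ioi (a := q k))
    calc _ = ∫ z, g k * ((Ioi (q k)).indicator (1 : ℝ → ℝ) (z.2 - c k * z.1)
        * (fderiv ℝ φ z (1, 0) + c k * fderiv ℝ φ z (0, 1))) ∂halfPlane := by
          refine integral_congr_ae ?_
          filter_upwards [e2] with z hz
          rw [hz]; ring
      _ = - ∫ x, g k * ((Ioi (q k)).indicator (1 : ℝ → ℝ) x * φ (0, x)) := by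
          rw [integral_const_mul, e3, integral_const_mul, mul_neg]
      _ = _ := by
          congr 1
          refine integral_congr_ae (Eventually.of_forall fun x => ?_)
          simp only [e1]; ring
  simp only [hpt]
  rw [integral_add (hφ1.const_mul _) hΦ.integral_prod_left, integral_const_mul, hmass,
    integral_integral_swap hΦ]
  rw [integral_congr_ae (hI.mono hline), integral_neg, ← integral_integral_swap hu₀]
  rw [mul_neg, ← neg_add, ← integral_const_mul, ← integral_add (hφ0.const_mul _)
    hu₀.integral_prod_left]
  congr 1
  refine integral_congr_ae (Eventually.of_forall fun x => ?_)
  simp only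
  rw [hEw _ (h.memU.mem_Ioo h.strictMono x), integral_mul_const]; ring

theorem IsSmoothData.isEntropySolution {f u₀ : ℝ → ℝ} (h : IsSmoothData (deriv f) u₀) :
    IsEntropySolution f u₀ (charSol (deriv f) u₀) where
  memLp_top := memLp_top_of_bound h.charSol_continuous.aestronglyMeasurable 1
    (Eventually.of_forall fun z => by
      have := h.charSol_mem_Ioo z.1 z.2
      rw [Real.norm_eq_abs, abs_of_pos this.1]; exact this.2.le)
  entropy_ineq E _ hE φ hφ hc _ := by
    obtain ⟨K, hK⟩ := hE
    have := h.entropy_eq hK (hφ.of_le (by exact_mod_cast le_top)) hc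
    rw [halfPlane] at this
    rw [this]; simp

theorem IsSmoothData.continuousInL1Loc {c u₀ : ℝ → ℝ} (h : IsSmoothData c u₀) :
    ContinuousInL1Loc (charSol c u₀) where
  locallyIntegrable t _ :=
    (h.charSol_continuous.comp (Continuous.prodMk_right t)).locallyIntegrable
  tendsto R t _ := by
    have hm : ∀ s, Continuous (charSol c u₀ s) := fun s =>
      h.charSol_continuous.comp (Continuous.prodMk_right s)
    rw [← lintegral_zero (μ := volume.restrict (Icc (-R) R))]
    refine tendsto_lintegral_filter_of_dominated_convergence (fun _ => 1)
      (Eventually.of_forall fun s => ((hm s).sub (hm t)).measurable.enorm)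
      (Eventually.of_forall fun s => Eventually.of_forall fun x => ?_) ?_
      (Eventually.of_forall fun x => ?_)
    · have h1 := h.charSol_mem_Ioo s x
      have h2 := h.charSol_mem_Ioo t x
      rw [Real.enorm_eq_ofReal_abs, ENNReal.ofReal_le_one, abs_le]
      constructor <;> linarith [h1.1, h1.2, h2.1, h2.2]
    · simp
    · have : Continuous fun s => ‖charSol c u₀ s x - charSol c u₀ t x‖ₑ :=
        ((h.charSol_continuous.comp (Continuous.prodMk_left x)).sub continuous_const).enorm
      simpa using (this.tendsto t).mono_left nhdsWithin_le_nhds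

end ConservationLaw

namespace ConservationLaw

/-! ### Uniqueness of the entropy solution -/

/-- The factor `e^{-t}` yields `θ' ≤ -θ`, the damping that later forces a density to vanish; the
factor in `t + 1` equals `1` for `t ≥ 0` and only makes the support compact. -/
theorem exists_time_cutoff (T : ℝ) :
    ∃ θ : ℝ → ℝ, ContDiff ℝ ∞ θ ∧ (∀ t, 0 ≤ θ t) ∧ (∀ t, 0 < t → deriv θ t ≤ -θ t) ∧
      (∀ t, 0 < t → t < T → 0 < θ t) ∧ ∀ t, θ t ≠ 0 → t ∈ Icc (-1) T := by
  have hst : ContDiff ℝ ∞ Real.smoothTransition := Real.smoothTransition.contDiff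
  refine ⟨fun t => Real.exp (-t) * (Real.smoothTransition (T - t) *
    Real.smoothTransition (t + 1)), ?_, fun t => ?_, fun t ht => ?_, fun t ht htT => ?_,
    fun t ht => ?_⟩
  · exact (Real.contDiff_exp.comp contDiff_neg).mul
      ((hst.comp (contDiff_const.sub contDiff_id)).mul (hst.comp (contDiff_id.add contDiff_const)))
  · have := Real.smoothTransition.nonneg (T - t)
    have := Real.smoothTransition.nonneg (t + 1)
    positivity
  · have hev : (fun t => Real.exp (-t) * (Real.smoothTransition (T - t) *
        Real.smoothTransition (t + 1))) =ᶠ[𝓝 t]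
        fun t => Real.exp (-t) * Real.smoothTransition (T - t) := by
      filter_upwards [lt_mem_nhds ht] with s hs
      rw [Real.smoothTransition.one_of_one_le (x := s + 1) (by linarith), mul_one]
    have h1 : HasDerivAt (fun t => Real.smoothTransition (T - t))
        (deriv Real.smoothTransition (T - t) * -1) t :=
      (hst.differentiable (by simp) (T - t)).hasDerivAt.comp t
        ((hasDerivAt_id t).const_sub T)
    have h2 : HasDerivAt (fun t => Real.exp (-t)) (Real.exp (-t) * -1) t :=
      (hasDerivAt_id t).neg.exp
    have h3 : 0 ≤ deriv Real.smoothTransition (T - t) :=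
      Real.smoothTransition.monotone.deriv_nonneg
    have h4 : HasDerivAt (fun t => Real.exp (-t) * Real.smoothTransition (T - t)) _ t :=
      h2.mul h1
    simp only
    rw [hev.deriv_eq, h4.deriv, Real.smoothTransition.one_of_one_le (x := t + 1) (by linarith), mul_one]
    have := mul_nonneg (Real.exp_pos (-t)).le h3
    linarith
  · have := Real.smoothTransition.pos_of_pos (x := T - t) (by linarith)
    have := Real.smoothTransition.pos_of_pos (x := t + 1) (by linarith)
    positivity
  · by_contra hcon
    refine ht ?_
    rw [mem_Icc, not_and_or, not_le, not_le] at hcon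
    rcases hcon with hcon | hcon
    · simp only [Real.smoothTransition.zero_of_nonpos (x := t + 1) (by linarith), mul_zero]
    · simp only [Real.smoothTransition.zero_of_nonpos (x := T - t) (by linarith), mul_zero,
        zero_mul]

theorem fderiv_apply_fst_eq {φ : ℝ × ℝ → ℝ} (hφ : Differentiable ℝ φ) {t x d : ℝ}
    (h : HasDerivAt (fun s => φ (s, x)) d t) : fderiv ℝ φ (t, x) (1, 0) = d :=
  ((hφ (t, x)).hasFDerivAt.comp_hasDerivAt (f := fun s => (s, x)) t
    ((hasDerivAt_id t).prodMk (hasDerivAt_const t x))).unique h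

theorem fderiv_apply_snd_eq {φ : ℝ × ℝ → ℝ} (hφ : Differentiable ℝ φ) {t x d : ℝ}
    (h : HasDerivAt (fun y => φ (t, y)) d x) : fderiv ℝ φ (t, x) (0, 1) = d :=
  ((hφ (t, x)).hasFDerivAt.comp_hasDerivAt (f := fun y => (t, y)) x
    ((hasDerivAt_const x t).prodMk (hasDerivAt_id x))).unique h

/-- Test functions supported on one side of the line `x = y + a t`, which are supersolutions
of every transport equation whose speed is at most `L` and lies on the right side of `a`. -/
theorem exists_test_function {σ : ℝ} (hσ : σ = 1 ∨ σ = -1) (a y : ℝ) {L : ℝ} (hL : 0 ≤ L)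
    {T : ℝ} (hT : 0 < T) :
    ∃ φ : ℝ × ℝ → ℝ, ContDiff ℝ ∞ φ ∧ HasCompactSupport φ ∧ (∀ z, 0 ≤ φ z) ∧
      (∀ x, φ (0, x) ≠ 0 → σ * (x - y) < 0) ∧
      (∀ t x, 0 < t → t < T → σ * (x - y - a * t) < 0 → L * t - T < σ * x → 0 < φ (t, x)) ∧
      ∀ t x, 0 < t → ∀ e g : ℝ, 0 ≤ e → 0 ≤ σ * (g - a * e) → |g| ≤ L * e →
        e * fderiv ℝ φ (t, x) (1, 0) + g * fderiv ℝ φ (t, x) (0, 1) ≤ -(e * φ (t, x)) := by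
  obtain ⟨θ, hθ, hθ0, hθd, hθpos, hθs⟩ := exists_time_cutoff T
  have hst : ContDiff ℝ ∞ Real.smoothTransition := Real.smoothTransition.contDiff
  set st := Real.smoothTransition
  have hst0 : ∀ x, 0 ≤ st x := Real.smoothTransition.nonneg
  have hstpos : ∀ {x}, 0 < x → 0 < st x := Real.smoothTransition.pos_of_pos
  have hstz : ∀ {x}, st x ≠ 0 → 0 < x := fun {x} hx => by
    by_contra! hneg; exact hx (Real.smoothTransition.zero_of_nonpos hneg)
  -- The first factor selects one side of the line, the second a region receding at the maximal
  -- speed `L`, the third a time interval. None increases along the admissible directions `(e, g)`.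
  set φ : ℝ × ℝ → ℝ := fun z =>
    st (-(σ * (z.2 - y - a * z.1))) * st (σ * z.2 + T - L * z.1) * θ z.1 with hφdef
  have hφ : ContDiff ℝ ∞ φ := by
    refine ((hst.comp ?_).mul (hst.comp ?_)).mul (hθ.comp contDiff_fst)
    · exact (contDiff_const.mul ((contDiff_snd.sub contDiff_const).sub
        (contDiff_const.mul contDiff_fst))).neg
    · exact ((contDiff_const.mul contDiff_snd).add contDiff_const).sub
        (contDiff_const.mul contDiff_fst)
  have hne : ∀ z, φ z ≠ 0 → σ * (z.2 - y - a * z.1) < 0 ∧ 0 < σ * z.2 + T - L * z.1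
      ∧ z.1 ∈ Icc (-1) T := by
    intro z hz
    have h1 := left_ne_zero_of_mul hz
    exact ⟨by linarith [hstz (left_ne_zero_of_mul h1)], hstz (right_ne_zero_of_mul h1),
      hθs _ (right_ne_zero_of_mul hz)⟩
  have hdiff : Differentiable ℝ φ := hφ.differentiable (by simp)
  refine ⟨φ, hφ, ?_, fun z => mul_nonneg (mul_nonneg (hst0 _) (hst0 _)) (hθ0 _),
    fun x hx => by simpa using (hne _ hx).1, ?_, ?_⟩
  · set N := |y| + |a| * (T + 1) + L + T
    refine HasCompactSupport.intro (isCompact_Icc.prod isCompact_Icc)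
      (K := Icc (-1) T ×ˢ Icc (-N) N) fun z hz => ?_
    by_contra hcon
    refine hz ?_
    obtain ⟨h1, h2, h3⟩ := hne z hcon
    have b1 : |a * z.1| ≤ |a| * (T + 1) := by
      rw [abs_mul]
      gcongr
      rw [abs_le]; constructor <;> linarith [h3.1, h3.2]
    have b2 : -L ≤ L * z.1 := by nlinarith [h3.1]
    have := abs_le.1 b1
    have := neg_abs_le y
    have := le_abs_self y
    have := mul_nonneg (abs_nonneg a) (by linarith : 0 ≤ T + 1)
    refine ⟨h3, ?_⟩
    rcases hσ with rfl | rfl <;> constructor <;> simp only [N] <;> linarith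
  · intro t x ht htT h1 h2
    exact mul_pos (mul_pos (hstpos (by linarith)) (hstpos (by simp only; linarith)))
      (hθpos t ht htT)
  · intro t x ht e g he hg hgL
    have hdst : ∀ x, HasDerivAt st (deriv st x) x := fun x =>
      (hst.differentiable (by simp) x).hasDerivAt
    have hdst0 : ∀ x, 0 ≤ deriv st x := fun x => Real.smoothTransition.monotone.deriv_nonneg
    set X := -(σ * (x - y - a * t))
    set Y := σ * x + T - L * t
    have dt : HasDerivAt (fun s => φ (s, x))
        ((deriv st X * (σ * a) * st Y + st X * (deriv st Y * -L)) * θ t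
          + st X * st Y * deriv θ t) t := by
      refine HasDerivAt.mul (HasDerivAt.mul ?_ ?_) (hθ.differentiable (by simp) t).hasDerivAt
      · refine HasDerivAt.comp t (h := fun s => -(σ * (x - y - a * s))) (hdst X) ?_
        have := (((hasDerivAt_id t).const_mul a).const_sub (x - y)).const_mul σ |>.neg
        refine this.congr_deriv ?_
        ring
      · refine HasDerivAt.comp t (h := fun s => σ * x + T - L * s) (hdst Y) ?_
        refine (((hasDerivAt_id t).const_mul L).const_sub (σ * x + T)).congr_deriv ?_
        ring
    have dx : HasDerivAt (fun s => φ (t, s))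
        ((deriv st X * (-σ) * st Y + st X * (deriv st Y * σ)) * θ t) x := by
      refine HasDerivAt.mul_const (c := fun s => st (-(σ * (s - y - a * t)))
        * st (σ * s + T - L * t)) (HasDerivAt.mul ?_ ?_) (θ t)
      · refine HasDerivAt.comp x (h := fun s => -(σ * (s - y - a * t))) (hdst X) ?_
        have := (((hasDerivAt_id x).sub_const y).sub_const (a * t)).const_mul σ |>.neg
        refine this.congr_deriv ?_
        ring
      · refine HasDerivAt.comp x (h := fun s => σ * s + T - L * t) (hdst Y) ?_
        refine ((((hasDerivAt_id x).const_mul σ).add_const T).sub_const (L * t)).congr_deriv ?_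
        ring
    rw [fderiv_apply_fst_eq hdiff dt, fderiv_apply_snd_eq hdiff dx]
    have hval : φ (t, x) = st X * st Y * θ t := rfl
    rw [hval]
    -- The gap between the two sides is exactly the sum of the next three losses, one per factor.
    have t1 : 0 ≤ deriv st X * st Y * θ t * (σ * (g - a * e)) :=
      mul_nonneg (mul_nonneg (mul_nonneg (hdst0 _) (hst0 _)) (hθ0 _)) hg
    have hσg : 0 ≤ L * e - σ * g := by
      have := abs_le.1 hgL
      rcases hσ with rfl | rfl <;> linarith
    have t2 : 0 ≤ st X * deriv st Y * θ t * (L * e - σ * g) :=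
      mul_nonneg (mul_nonneg (mul_nonneg (hst0 _) (hdst0 _)) (hθ0 _)) hσg
    have t3 : 0 ≤ e * (st X * st Y) * (-θ t - deriv θ t) :=
      mul_nonneg (mul_nonneg he (mul_nonneg (hst0 _) (hst0 _))) (by linarith [hθd t ht])
    linarith

/-! ### Vanishing of densities under a transport inequality -/

theorem integral_halfPlane_deriv_snd {φ : ℝ × ℝ → ℝ} (hφ : ContDiff ℝ 1 φ)
    (hc : HasCompactSupport φ) : ∫ z, fderiv ℝ φ z (0, 1) ∂halfPlane = 0 := by
  have h0 := integral_halfPlane_deriv_line hφ hc 0 MeasurableSet.univ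
  have h1 := integral_halfPlane_deriv_line hφ hc 1 MeasurableSet.univ
  simp only [indicator_univ, Pi.one_apply, one_mul, zero_mul, add_zero] at h0 h1
  rw [← h0, integral_add (integrable_fderiv_apply hφ hc _) (integrable_fderiv_apply hφ hc _)] at h1
  linarith

theorem ae_halfPlane_pos : ∀ᵐ z ∂halfPlane, 0 < z.1 := by
  filter_upwards [ae_restrict_mem (measurableSet_Ioi.prod MeasurableSet.univ)] with z hz
  exact hz.1

/-- A nonnegative density `e` with flux `g` satisfying a transport inequality vanishes on the
side of a characteristic line through which nothing enters. -/
theorem ae_eq_zero_of_transport_ineq {σ : ℝ} (hσ : σ = 1 ∨ σ = -1) (a y : ℝ) {L : ℝ}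
    (hL : 0 ≤ L) {e g : ℝ × ℝ → ℝ} (hem : AEStronglyMeasurable e halfPlane)
    (hgm : AEStronglyMeasurable g halfPlane) {B : ℝ} (heB : ∀ᵐ z ∂halfPlane, |e z| ≤ B)
    (he : ∀ z, 0 ≤ e z) (hg : ∀ᵐ z ∂halfPlane, 0 ≤ σ * (g z - a * e z))
    (hgL : ∀ᵐ z ∂halfPlane, |g z| ≤ L * e z) (C : ℝ)
    (H : ∀ φ : ℝ × ℝ → ℝ, ContDiff ℝ ∞ φ → HasCompactSupport φ → (∀ z, 0 ≤ φ z) →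
      (∀ x, φ (0, x) ≠ 0 → σ * (x - y) < 0) →
      0 ≤ ∫ z, (e z * fderiv ℝ φ z (1, 0) + (g z + C) * fderiv ℝ φ z (0, 1)) ∂halfPlane) :
    ∀ᵐ z ∂halfPlane, σ * (z.2 - y - a * z.1) < 0 → e z = 0 := by
  -- The horizons `T = n + 1` make the positivity sets of the test functions exhaust the chosen side
  -- of the line.
  have hT : ∀ n : ℕ, 0 < (n : ℝ) + 1 := fun n => by positivity
  choose φ hφ hc h0 hinit hpos hineq using fun n : ℕ => exists_test_function hσ a y hL (hT n)
  have key : ∀ n, ∀ᵐ z ∂halfPlane, e z * φ n z = 0 := by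
    intro n
    have h1 : ContDiff ℝ 1 (φ n) := (hφ n).of_le (by exact_mod_cast le_top)
    have i1 : Integrable (fun z => e z * fderiv ℝ (φ n) z (1, 0)) halfPlane :=
      (integrable_fderiv_apply h1 (hc n) _).bdd_mul hem heB
    have hgB : ∀ᵐ z ∂halfPlane, ‖g z‖ ≤ L * B := by
      filter_upwards [hgL, heB] with z hz hz'
      exact hz.trans (mul_le_mul_of_nonneg_left ((le_abs_self _).trans hz') hL)
    have i2 : Integrable (fun z => g z * fderiv ℝ (φ n) z (0, 1)) halfPlane :=
      (integrable_fderiv_apply h1 (hc n) _).bdd_mul hgm hgB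
    have i3 : Integrable (fun z => C * fderiv ℝ (φ n) z (0, 1)) halfPlane :=
      (integrable_fderiv_apply h1 (hc n) _).const_mul C
    have i4 : Integrable (fun z => e z * φ n z) halfPlane :=
      (((h1.continuous.integrable_of_hasCompactSupport (hc n)).integrableOn
        (s := Ioi 0 ×ˢ univ)).bdd_mul hem heB)
    have hH := H (φ n) (hφ n) (hc n) (h0 n) (hinit n)
    -- The constant `C` absorbs the normalisation of entropy fluxes at `0`; it is harmless since
    -- `∂_x φ` has zero integral.
    have hsplit : ∫ z, (e z * fderiv ℝ (φ n) z (1, 0) + (g z + C) * fderiv ℝ (φ n) z (0, 1))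
        ∂halfPlane = ∫ z, (e z * fderiv ℝ (φ n) z (1, 0) + g z * fderiv ℝ (φ n) z (0, 1))
        ∂halfPlane := by
      have : ∀ z, e z * fderiv ℝ (φ n) z (1, 0) + (g z + C) * fderiv ℝ (φ n) z (0, 1)
          = (e z * fderiv ℝ (φ n) z (1, 0) + g z * fderiv ℝ (φ n) z (0, 1))
            + C * fderiv ℝ (φ n) z (0, 1) := fun z => by ring
      simp only [this]
      have i12 : Integrable (fun z => e z * fderiv ℝ (φ n) z (1, 0)
        + g z * fderiv ℝ (φ n) z (0, 1)) halfPlane := i1.add i2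
      rw [integral_add i12 i3, integral_const_mul,
        integral_halfPlane_deriv_snd h1 (hc n), mul_zero, add_zero]
    rw [hsplit] at hH
    -- Combined with `hH`, this gives `0 ≤ -∫ e φ`, while `e φ ≥ 0`.
    have hle : ∫ z, (e z * fderiv ℝ (φ n) z (1, 0) + g z * fderiv ℝ (φ n) z (0, 1)) ∂halfPlane
        ≤ ∫ z, -(e z * φ n z) ∂halfPlane := by
      refine integral_mono_ae (i1.add i2) i4.neg ?_
      filter_upwards [hg, hgL, ae_halfPlane_pos] with z h1 h2 h3
      exact hineq n z.1 z.2 h3 (e z) (g z) (he z) h1 h2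
    rw [integral_neg] at hle
    have hnn : 0 ≤ fun z => e z * φ n z := fun z => mul_nonneg (he z) (h0 n z)
    have hz : ∫ z, e z * φ n z ∂halfPlane = 0 :=
      le_antisymm (by linarith) (integral_nonneg hnn)
    exact (integral_eq_zero_iff_of_nonneg hnn i4).1 hz
  filter_upwards [ae_all_iff.2 key, ae_halfPlane_pos] with z hz hz0 hside
  obtain ⟨n, hn⟩ := exists_nat_gt (max z.1 (L * z.1 - σ * z.2))
  have hn1 := (le_max_left _ _).trans_lt hn
  have hn2 := (le_max_right _ _).trans_lt hn
  have := hpos n z.1 z.2 hz0 (by linarith) hside (by linarith)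
  exact (mul_eq_zero.1 (hz n)).resolve_right this.ne'

/-! ### Truncation entropies and comparison with the lines of constant level -/

/-- The exceptional point `k` accommodates the kink of the entropies `(w - k)⁺` and `(k - w)⁺`. -/
theorem entropyFlux_eq_of_hasDerivAt {f E G : ℝ → ℝ} (hf : Continuous (deriv f)) {K : ℝ≥0}
    (hE : LipschitzWith K E) (hG : Continuous G) (k : ℝ)
    (hd : ∀ v, v ≠ k → HasDerivAt G (deriv f v * deriv E v) v) (w : ℝ) :
    entropyFlux f E w = G w - G 0 := by
  refine integral_eq_of_hasDerivAt_off_countable G _ (countable_singleton k)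
    hG.continuousOn (fun v hv => hd v hv.2) ?_
  have h1 : IntervalIntegrable (deriv f) volume 0 w := hf.intervalIntegrable _ _
  have hb : ∀ v, ‖deriv E v‖ ≤ K := fun v => norm_deriv_le_of_lipschitz hE
  exact ⟨h1.1.mul_bdd (measurable_deriv E).aestronglyMeasurable (Eventually.of_forall hb),
    h1.2.mul_bdd (measurable_deriv E).aestronglyMeasurable (Eventually.of_forall hb)⟩

theorem convexOn_max_sub (k : ℝ) : ConvexOn ℝ univ fun w : ℝ => max (w - k) 0 :=
  ((convexOn_id convex_univ).sub (concaveOn_const k convex_univ)).sup (convexOn_const 0 convex_univ)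

theorem convexOn_max_sub' (k : ℝ) : ConvexOn ℝ univ fun w : ℝ => max (k - w) 0 :=
  ((convexOn_const k convex_univ).sub (concaveOn_id convex_univ)).sup (convexOn_const 0 convex_univ)

theorem lipschitzWith_max_sub (k : ℝ) : LipschitzWith 1 fun w : ℝ => max (w - k) 0 :=
  (LipschitzWith.of_dist_le_mul fun a b => by simp [Real.dist_eq]).max_const 0

theorem lipschitzWith_max_sub' (k : ℝ) : LipschitzWith 1 fun w : ℝ => max (k - w) 0 :=
  (LipschitzWith.of_dist_le_mul fun a b => by
    rw [Real.dist_eq, Real.dist_eq, abs_sub_comm a b]; simp).max_const 0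

theorem entropyFlux_max_sub {f : ℝ → ℝ} (hf : ContDiff ℝ 2 f) (k w : ℝ) :
    entropyFlux f (fun w => max (w - k) 0) w = f (max w k) - f (max 0 k) := by
  refine entropyFlux_eq_of_hasDerivAt (hf.continuous_deriv one_le_two) (lipschitzWith_max_sub k)
    (G := fun v => f (max v k)) (hf.continuous.comp (by fun_prop)) k (fun v hv => ?_) w
  rcases hv.lt_or_gt with h | h
  · have e1 : (fun w => max (w - k) 0) =ᶠ[𝓝 v] fun _ => 0 := by
      filter_upwards [gt_mem_nhds h] with s hs using max_eq_right (by linarith)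
    have e2 : (fun v => f (max v k)) =ᶠ[𝓝 v] fun _ => f k := by
      filter_upwards [gt_mem_nhds h] with s hs
      rw [max_eq_right hs.le]
    rw [e1.deriv_eq, deriv_const, mul_zero]
    exact (hasDerivAt_const v (f k)).congr_of_eventuallyEq e2
  · have e1 : (fun w => max (w - k) 0) =ᶠ[𝓝 v] fun w => w - k := by
      filter_upwards [lt_mem_nhds h] with s hs using max_eq_left (by linarith)
    have e2 : (fun v => f (max v k)) =ᶠ[𝓝 v] f := by
      filter_upwards [lt_mem_nhds h] with s hs
      rw [max_eq_left hs.le]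
    rw [e1.deriv_eq, deriv_sub_const_fun, deriv_id'', mul_one]
    exact (hf.differentiable two_ne_zero v).hasDerivAt.congr_of_eventuallyEq e2

theorem entropyFlux_max_sub' {f : ℝ → ℝ} (hf : ContDiff ℝ 2 f) (k w : ℝ) :
    entropyFlux f (fun w => max (k - w) 0) w = -f (min w k) - -f (min 0 k) := by
  refine entropyFlux_eq_of_hasDerivAt (hf.continuous_deriv one_le_two) (lipschitzWith_max_sub' k)
    (G := fun v => -f (min v k)) (hf.continuous.comp (by fun_prop)).neg k (fun v hv => ?_) w
  rcases hv.lt_or_gt with h | h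
  · have e1 : (fun w => max (k - w) 0) =ᶠ[𝓝 v] fun w => k - w := by
      filter_upwards [gt_mem_nhds h] with s hs using max_eq_left (by linarith)
    have e2 : (fun v => -f (min v k)) =ᶠ[𝓝 v] fun v => -f v := by
      filter_upwards [gt_mem_nhds h] with s hs
      rw [min_eq_left hs.le]
    rw [e1.deriv_eq, deriv_const_sub, deriv_id'', mul_neg_one]
    exact (hf.differentiable two_ne_zero v).hasDerivAt.neg.congr_of_eventuallyEq e2
  · have e1 : (fun w => max (k - w) 0) =ᶠ[𝓝 v] fun _ => 0 := by
      filter_upwards [lt_mem_nhds h] with s hs using max_eq_right (by linarith)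
    have e2 : (fun v => -f (min v k)) =ᶠ[𝓝 v] fun _ => -f k := by
      filter_upwards [lt_mem_nhds h] with s hs
      rw [min_eq_right hs.le]
    rw [e1.deriv_eq, deriv_const, mul_zero]
    exact (hasDerivAt_const v (-f k)).congr_of_eventuallyEq e2

/-- Consequently the excess over `k` moves at speed at least `f'(k)`, and the deficit below `k` at
speed at most `f'(k)`: neither crosses the line of level `k` to the side where it is initially
absent. -/
theorem tangent_le {f : ℝ → ℝ} (hfc : ConvexOn ℝ univ f) (hf : Differentiable ℝ f) (k v : ℝ) :
    deriv f k * (v - k) ≤ f v - f k := by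
  rcases lt_trichotomy k v with h | rfl | h
  · have := hfc.deriv_le_slope (mem_univ k) (mem_univ v) h (hf k)
    rwa [slope_def_field, le_div_iff₀ (by linarith)] at this
  · simp
  · have := hfc.slope_le_deriv (mem_univ v) (mem_univ k) h (hf k)
    rw [slope_def_field, div_le_iff₀ (by linarith)] at this
    linarith

theorem exists_lipschitz_bound {f : ℝ → ℝ} (hf : ContDiff ℝ 2 f) (B : ℝ) :
    ∃ L : ℝ, 0 ≤ L ∧ ∀ v ∈ Icc (-B) B, ∀ w ∈ Icc (-B) B, |f v - f w| ≤ L * |v - w| := by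
  obtain ⟨C, hC⟩ := isCompact_Icc.exists_bound_of_continuousOn (s := Icc (-B) B)
    (hf.continuous_deriv one_le_two).continuousOn
  refine ⟨max C 0, le_max_right _ _, fun v hv w hw => ?_⟩
  exact (convex_Icc (-B) B).norm_image_sub_le_of_norm_deriv_le
    (fun x _ => hf.differentiable two_ne_zero x)
    (fun x hx => (hC x hx).trans (le_max_left _ _)) hw hv

theorem IsEntropySolution.exists_bound {f u₀ : ℝ → ℝ} {w : ℝ → ℝ → ℝ}
    (hw : IsEntropySolution f u₀ w) :
    AEStronglyMeasurable (fun z : ℝ × ℝ => w z.1 z.2) halfPlane ∧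
      ∃ B : ℝ, 1 ≤ B ∧ ∀ᵐ z ∂halfPlane, w z.1 z.2 ∈ Icc (-B) B := by
  have h := hw.memLp_top.mono_measure (Measure.restrict_mono
    (prod_mono Ioi_subset_Ici_self (subset_refl _)) le_rfl :
    halfPlane ≤ volume.restrict (Ici 0 ×ˢ univ))
  -- The maximum with `1` places all levels of `]0,1[` in `[-B, B]`.
  refine ⟨h.1, max (eLpNormEssSup (fun z : ℝ × ℝ => w z.1 z.2) halfPlane).toReal 1,
    le_max_right _ _, ?_⟩
  have htop : eLpNormEssSup (fun z : ℝ × ℝ => w z.1 z.2) halfPlane ≠ ⊤ := by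
    rw [← eLpNorm_exponent_top]; exact h.2.ne
  filter_upwards [enorm_ae_le_eLpNormEssSup (fun z : ℝ × ℝ => w z.1 z.2) halfPlane] with z hz
  rw [mem_Icc, ← abs_le, ← Real.norm_eq_abs]
  refine le_max_of_le_left ?_
  rw [← toReal_enorm]
  exact ENNReal.toReal_mono htop hz

/-- An entropy solution stays below the level `k` on the left of the line `x = y + f'(k) t`. -/
theorem IsEntropySolution.ae_le {f u₀ : ℝ → ℝ} (hf : ContDiff ℝ 2 f) (hfc : ConvexOn ℝ univ f)
    {w : ℝ → ℝ → ℝ} (hw : IsEntropySolution f u₀ w) {k y : ℝ} (hk : k ∈ Ioo (0 : ℝ) 1)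
    (hy : ∀ x < y, u₀ x ≤ k) :
    ∀ᵐ z ∂halfPlane, z.2 < y + z.1 * deriv f k → w z.1 z.2 ≤ k := by
  obtain ⟨hwm, B, hB1, hB⟩ := hw.exists_bound
  obtain ⟨L, hL, hLip⟩ := exists_lipschitz_bound hf B
  have hkB : k ∈ Icc (-B) B := ⟨by linarith [hk.1], by linarith [hk.2]⟩
  have hmax : ∀ v : ℝ, max v k - k = max (v - k) 0 := fun v => by
    rcases le_total v k with h | h <;> simp [h]
  have := ae_eq_zero_of_transport_ineq (σ := 1) (Or.inl rfl) (deriv f k) y hL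
    (e := fun z => max (w z.1 z.2 - k) 0) (g := fun z => f (max (w z.1 z.2) k) - f k)
    (B := 2 * B) ?_ ?_ ?_ (fun z => le_max_right _ _) ?_ ?_ (f k - f (max 0 k)) ?_
  · filter_upwards [this] with z hz hside
    have := hz (by linarith)
    by_contra! hlt
    rw [max_eq_left (by linarith)] at this
    linarith
  · exact (by fun_prop : Continuous fun v : ℝ => max (v - k) 0).comp_aestronglyMeasurable hwm
  · exact ((hf.continuous.comp (by fun_prop : Continuous fun v : ℝ => max v k)).sub
      continuous_const).comp_aestronglyMeasurable hwm
  · filter_upwards [hB] with z hz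
    rw [abs_of_nonneg (le_max_right _ _)]
    exact max_le (by linarith [hz.2, hkB.1]) (by linarith)
  · refine Eventually.of_forall fun z => ?_
    have h1 := tangent_le hfc (hf.differentiable two_ne_zero) k (max (w z.1 z.2) k)
    rw [hmax] at h1
    linarith
  · filter_upwards [hB] with z hz
    have h1 := hLip (max (w z.1 z.2) k) ⟨le_max_of_le_right hkB.1, max_le hz.2 hkB.2⟩ k hkB
    rwa [hmax, abs_of_nonneg (le_max_right (w z.1 z.2 - k) 0)] at h1
  · intro φ hφ hc h0 hinit
    have hent := hw.entropy_ineq _ (convexOn_max_sub k) ⟨1, lipschitzWith_max_sub k⟩ φ hφ hc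
      (fun t x _ => h0 _)
    have hzero : ∀ x, max (u₀ x - k) 0 * φ (0, x) = 0 := by
      intro x
      by_cases hx : φ (0, x) = 0
      · rw [hx, mul_zero]
      · rw [max_eq_right (by linarith [hy x (by linarith [hinit x hx])]), zero_mul]
    simp only [hzero, integral_zero, add_zero, entropyFlux_max_sub hf] at hent
    simp only [sub_add_sub_cancel]
    exact hent

/-- An entropy solution stays above the level `k` on the right of the line `x = y + f'(k) t`. -/
theorem IsEntropySolution.ae_ge {f u₀ : ℝ → ℝ} (hf : ContDiff ℝ 2 f) (hfc : ConvexOn ℝ univ f)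
    {w : ℝ → ℝ → ℝ} (hw : IsEntropySolution f u₀ w) {k y : ℝ} (hk : k ∈ Ioo (0 : ℝ) 1)
    (hy : ∀ x, y < x → k ≤ u₀ x) :
    ∀ᵐ z ∂halfPlane, y + z.1 * deriv f k < z.2 → k ≤ w z.1 z.2 := by
  obtain ⟨hwm, B, hB1, hB⟩ := hw.exists_bound
  obtain ⟨L, hL, hLip⟩ := exists_lipschitz_bound hf B
  have hkB : k ∈ Icc (-B) B := ⟨by linarith [hk.1], by linarith [hk.2]⟩
  have hmin : ∀ v : ℝ, k - min v k = max (k - v) 0 := fun v => by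
    rcases le_total v k with h | h <;> simp [h]
  have := ae_eq_zero_of_transport_ineq (σ := -1) (Or.inr rfl) (deriv f k) y hL
    (e := fun z => max (k - w z.1 z.2) 0) (g := fun z => f k - f (min (w z.1 z.2) k))
    (B := 2 * B) ?_ ?_ ?_ (fun z => le_max_right _ _) ?_ ?_ (f (min 0 k) - f k) ?_
  · filter_upwards [this] with z hz hside
    have := hz (by linarith)
    by_contra! hlt
    rw [max_eq_left (by linarith)] at this
    linarith
  · exact (by fun_prop : Continuous fun v : ℝ => max (k - v) 0).comp_aestronglyMeasurable hwm
  · exact (continuous_const.sub (hf.continuous.comp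
      (by fun_prop : Continuous fun v : ℝ => min v k))).comp_aestronglyMeasurable hwm
  · filter_upwards [hB] with z hz
    rw [abs_of_nonneg (le_max_right _ _)]
    exact max_le (by linarith [hz.1, hkB.2]) (by linarith)
  · refine Eventually.of_forall fun z => ?_
    have h1 := tangent_le hfc (hf.differentiable two_ne_zero) k (min (w z.1 z.2) k)
    rw [← hmin]
    linarith
  · filter_upwards [hB] with z hz
    have h1 := hLip k hkB (min (w z.1 z.2) k) ⟨le_min hz.1 hkB.1, min_le_of_right_le hkB.2⟩
    rwa [hmin, abs_of_nonneg (le_max_right (k - w z.1 z.2) 0)] at h1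
  · intro φ hφ hc h0 hinit
    have hent := hw.entropy_ineq _ (convexOn_max_sub' k) ⟨1, lipschitzWith_max_sub' k⟩ φ hφ hc
      (fun t x _ => h0 _)
    have hzero : ∀ x, max (k - u₀ x) 0 * φ (0, x) = 0 := by
      intro x
      by_cases hx : φ (0, x) = 0
      · rw [hx, mul_zero]
      · rw [max_eq_right (by linarith [hy x (by linarith [hinit x hx])]), zero_mul]
    simp only [hzero, integral_zero, add_zero, entropyFlux_max_sub' hf] at hent
    refine hent.trans_eq (integral_congr_ae (Eventually.of_forall fun z => ?_))
    ring

/-! ### From almost every point of the half-plane to every time -/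

/-- Fubini gives equality at almost every time; such times accumulate at any `t ≥ 0` from the right,
`t = 0` included, and `L¹_loc` continuity passes to the limit. -/
theorem ae_eq_of_ae_halfPlane_eq {u w : ℝ → ℝ → ℝ} (hu : ContinuousInL1Loc u)
    (hw : ContinuousInL1Loc w) (h : ∀ᵐ z ∂halfPlane, w z.1 z.2 = u z.1 z.2) {t : ℝ}
    (ht : 0 ≤ t) : w t =ᵐ[volume] u t := by
  have hslice : ∀ᵐ s ∂(volume.restrict (Ioi (0 : ℝ))), w s =ᵐ[volume] u s := by
    rw [halfPlane_eq_prod] at h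
    exact Measure.ae_ae_of_ae_prod h
  have hfreq : ∃ᶠ s in 𝓝[Ici 0] t, 0 ≤ s ∧ w s =ᵐ[volume] u s := by
    have hle : 𝓝[>] t ≤ 𝓝[Ici 0] t := nhdsWithin_mono t fun s hs => ht.trans (le_of_lt hs)
    refine Frequently.filter_mono ?_ hle
    intro hev
    obtain ⟨b, hb, hsub⟩ := (mem_nhdsGT_iff_exists_Ioo_subset).1 hev
    rw [ae_restrict_iff' measurableSet_Ioi] at hslice
    have hz : volume (Ioo t b) = 0 := by
      refine measure_mono_null (fun s hs => ?_) (ae_iff.1 hslice)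
      intro hcon
      have h0 : 0 < s := ht.trans_lt hs.1
      exact hsub hs ⟨h0.le, hcon h0⟩
    rw [Real.volume_Ioo, ENNReal.ofReal_eq_zero] at hz
    linarith [mem_Ioi.1 hb]
  have hwm := (hw.locallyIntegrable t ht).aestronglyMeasurable
  have hum := (hu.locallyIntegrable t ht).aestronglyMeasurable
  have hR : ∀ n : ℕ, ∀ᵐ x, x ∈ Icc (-(n : ℝ)) n → w t x = u t x := by
    intro n
    have hlim := (hw.tendsto n t ht).add (hu.tendsto n t ht)
    rw [add_zero] at hlim
    have hle : ∫⁻ x in Icc (-(n : ℝ)) n, ‖w t x - u t x‖ₑ ≤ 0 := by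
      refine ge_of_tendsto_of_frequently hlim (hfreq.mono ?_)
      rintro s ⟨hs0, hs⟩
      have hwsm := (hw.locallyIntegrable s hs0).aestronglyMeasurable
      have hm : AEMeasurable (fun x => ‖w s x - w t x‖ₑ) (volume.restrict (Icc (-(n : ℝ)) n)) :=
        (hwsm.sub hwm).restrict.enorm
      rw [← lintegral_add_left' hm]
      refine lintegral_mono_ae (ae_restrict_of_ae ?_)
      filter_upwards [hs] with x hx
      have : w t x - u t x = (u s x - u t x) - (w s x - w t x) := by rw [hx]; ring
      rw [this, add_comm]
      exact enorm_sub_le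
    have hm : AEMeasurable (fun x => ‖w t x - u t x‖ₑ) (volume.restrict (Icc (-(n : ℝ)) n)) :=
      (hwm.sub hum).restrict.enorm
    rw [nonpos_iff_eq_zero, lintegral_eq_zero_iff' hm,
      EventuallyEq, ae_restrict_iff' measurableSet_Icc] at hle
    filter_upwards [hle] with x hx hxn
    exact sub_eq_zero.1 (enorm_eq_zero.1 (hx hxn))
  filter_upwards [ae_all_iff.2 hR] with x hx
  obtain ⟨n, hn⟩ := exists_nat_ge |x|
  exact hx n (abs_le.1 hn)

theorem IsSmoothData.isTheEntropySolution {f u₀ : ℝ → ℝ} (h : IsSmoothData (deriv f) u₀)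
    (hf : ContDiff ℝ 2 f) (hfc : ConvexOn ℝ univ f) :
    IsTheEntropySolution f u₀ (charSol (deriv f) u₀) where
  isEntropySolution := h.isEntropySolution
  continuousInL1Loc := h.continuousInL1Loc
  unique w hw hwc t ht := by
    obtain ⟨q, hq⟩ := h.memU.exists_isQuantile h.contDiff.continuous
    refine ae_eq_of_ae_halfPlane_eq h.continuousInL1Loc hwc ?_ ht
    have h1 : ∀ k : ℚ, ∀ᵐ z ∂halfPlane, (k : ℝ) ∈ Ioo (0 : ℝ) 1 →
        z.2 < q k + z.1 * deriv f k → w z.1 z.2 ≤ k := fun k => by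
      by_cases hk : (k : ℝ) ∈ Ioo (0 : ℝ) 1
      · filter_upwards [hw.ae_le hf hfc hk (y := q k)
          fun x hx => (h.strictMono.monotone hx.le).trans_eq (hq k hk)] with z hz _ using hz
      · exact Eventually.of_forall fun z hk' => absurd hk' hk
    have h2 : ∀ k : ℚ, ∀ᵐ z ∂halfPlane, (k : ℝ) ∈ Ioo (0 : ℝ) 1 →
        q k + z.1 * deriv f k < z.2 → k ≤ w z.1 z.2 := fun k => by
      by_cases hk : (k : ℝ) ∈ Ioo (0 : ℝ) 1
      · filter_upwards [hw.ae_ge hf hfc hk (y := q k)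
          fun x hx => (hq k hk).symm.trans_le (h.strictMono.monotone hx.le)] with z hz _ using hz
      · exact Eventually.of_forall fun z hk' => absurd hk' hk
    filter_upwards [ae_all_iff.2 h1, ae_all_iff.2 h2, ae_halfPlane_pos] with z hz1 hz2 hz0
    have hu := h.charSol_mem_Ioo z.1 z.2
    refine le_antisymm ?_ ?_
    · by_contra! hlt
      -- The minimum with `1` keeps `k` in `]0,1[`, as `w` is not known to take values there. The
      -- point lies left of the line of level `k`, which contradicts `w > k`.
      obtain ⟨k, hk1, hk2⟩ := exists_rat_btwn (lt_min hlt hu.2)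
      have hk : (k : ℝ) ∈ Ioo (0 : ℝ) 1 := ⟨hu.1.trans hk1, hk2.trans_le (min_le_right _ _)⟩
      exact absurd (hz1 k hk ((h.charSol_lt_iff hq hz0.le hk z.2).1 hk1))
        (not_le.2 (hk2.trans_le (min_le_left _ _)))
    · by_contra! hlt
      obtain ⟨k, hk1, hk2⟩ := exists_rat_btwn (max_lt hlt hu.1)
      have hk : (k : ℝ) ∈ Ioo (0 : ℝ) 1 := ⟨(le_max_right _ _).trans_lt hk1, hk2.trans hu.2⟩
      exact absurd (hz2 k hk ((h.lt_charSol_iff hq hz0.le hk z.2).1 hk2))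
        (not_le.2 ((le_max_left _ _).trans_lt hk1))

end ConservationLaw

namespace ConservationLaw

/-! ### Conservation of the Wasserstein distance -/

/-- The quantile function changes by `t * c k`, which is bounded on `]0,1[`. -/
theorem IsSmoothData.memUp {c u₀ : ℝ → ℝ} (h : IsSmoothData c u₀) {p : ℝ} (hp : 1 ≤ p)
    (hU : MemUp p u₀) {t : ℝ} (ht : 0 ≤ t) : MemUp p (charSol c u₀ t) := by
  obtain ⟨q, hq⟩ := h.memU.exists_isQuantile h.contDiff.continuous
  rw [hq.memUp_iff h.memU h.strictMono hp] at hU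
  rw [(h.isQuantile_charSol hq ht).memUp_iff (h.charSol_memU ht) (h.charSol_strictMono ht) hp]
  refine hU.add (MemLp.of_bound
    (h.speed_contDiff.continuous.const_mul t).aestronglyMeasurable (t * max |c 0| |c 1|) ?_)
  refine (ae_restrict_iff' measurableSet_Ioo).2 (Eventually.of_forall fun k hk => ?_)
  rw [norm_mul, Real.norm_of_nonneg ht]
  exact mul_le_mul_of_nonneg_left
    (abs_le_max_abs_abs (h.speed_mono hk.1.le) (h.speed_mono hk.2.le)) ht

/-- Both quantile functions are shifted by the same `t * c k`, which cancels in their difference. -/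
theorem wasserstein_charSol {c u₀ v₀ : ℝ → ℝ} (hu : IsSmoothData c u₀) (hv : IsSmoothData c v₀)
    {p : ℝ} (hp : 1 ≤ p) {t : ℝ} (ht : 0 ≤ t) :
    wasserstein p (spaceDeriv (charSol c u₀ t)) (spaceDeriv (charSol c v₀ t))
      = wasserstein p (spaceDeriv u₀) (spaceDeriv v₀) := by
  obtain ⟨q, hq⟩ := hu.memU.exists_isQuantile hu.contDiff.continuous
  obtain ⟨r, hr⟩ := hv.memU.exists_isQuantile hv.contDiff.continuous
  have hqt := hu.isQuantile_charSol hq ht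
  have hrt := hv.isQuantile_charSol hr ht
  have mu := hu.charSol_strictMono ht
  have mv := hv.charSol_strictMono ht
  rw [hqt.spaceDeriv_eq (hu.charSol_memU ht) mu, hrt.spaceDeriv_eq (hv.charSol_memU ht) mv,
    hq.spaceDeriv_eq hu.memU hu.strictMono, hr.spaceDeriv_eq hv.memU hv.strictMono,
    wasserstein_map_unif (hqt.monotoneOn mu) (hrt.monotoneOn mv) hp,
    wasserstein_map_unif (hq.monotoneOn hu.strictMono) (hr.monotoneOn hv.strictMono) hp]
  simp only [add_sub_add_right_eq_sub]

/-- Both quantile functions lie in `L^p(]0,1[)`, hence so does their difference. -/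
theorem wasserstein_lt_top {u₀ v₀ : ℝ → ℝ} (hcu : Continuous u₀) (hcv : Continuous v₀)
    (hsu : StrictMono u₀) (hsv : StrictMono v₀) {p : ℝ} (hp : 1 ≤ p) (hu : MemUp p u₀)
    (hv : MemUp p v₀) : wasserstein p (spaceDeriv u₀) (spaceDeriv v₀) < ⊤ := by
  obtain ⟨q, hq⟩ := hu.1.exists_isQuantile hcu
  obtain ⟨r, hr⟩ := hv.1.exists_isQuantile hcv
  have hqm := hq.monotoneOn hsu
  have hrm := hr.monotoneOn hsv
  rw [hq.spaceDeriv_eq hu.1 hsu, hr.spaceDeriv_eq hv.1 hsv, wasserstein_map_unif hqm hrm hp]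
  refine ENNReal.rpow_lt_top_of_nonneg (by positivity) (ne_of_lt ?_)
  exact (lintegral_abs_rpow_lt_top_iff hp ((aemeasurable_unif hqm).sub (aemeasurable_unif hrm))).2
    (((hq.memUp_iff hu.1 hsu hp).1 hu).sub ((hr.memUp_iff hv.1 hsv hp).1 hv))

end ConservationLaw

theorem corollary1p10 (f : ℝ → ℝ) (hf : ContDiff ℝ 2 f) (hf_convex : ConvexOn ℝ univ f)
    (p : ℝ) (hp : 1 ≤ p) (u₀ v₀ : ℝ → ℝ)
    (hu₀ : ContDiff ℝ 1 u₀) (hu₀_incr : StrictMono u₀) (hu₀_mem : ConservationLaw.MemUp p u₀)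
    (hv₀ : ContDiff ℝ 1 v₀) (hv₀_incr : StrictMono v₀) (hv₀_mem : ConservationLaw.MemUp p v₀) :
    ∃ u v : ℝ → ℝ → ℝ,
      ConservationLaw.IsTheEntropySolution f u₀ u ∧
      ConservationLaw.IsTheEntropySolution f v₀ v ∧
      ConservationLaw.IsClassicalSolution f u₀ u ∧
      ConservationLaw.IsClassicalSolution f v₀ v ∧
      (∀ t : ℝ, 0 ≤ t →
        (ConservationLaw.MemUp p (u t) ∧ StrictMono (u t)) ∧
        (ConservationLaw.MemUp p (v t) ∧ StrictMono (v t))) ∧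
      (∀ t : ℝ, 0 ≤ t →
        ConservationLaw.wasserstein p (ConservationLaw.spaceDeriv (u t))
            (ConservationLaw.spaceDeriv (v t))
          = ConservationLaw.wasserstein p (ConservationLaw.spaceDeriv u₀)
            (ConservationLaw.spaceDeriv v₀) ∧
        ConservationLaw.wasserstein p (ConservationLaw.spaceDeriv u₀)
            (ConservationLaw.spaceDeriv v₀) < ⊤) := by

  have hu := ConservationLaw.isSmoothData_deriv hf hf_convex hu₀ hu₀_incr hu₀_mem.1
  have hv := ConservationLaw.isSmoothData_deriv hf hf_convex hv₀ hv₀_incr hv₀_mem.1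
  exact ⟨_, _, hu.isTheEntropySolution hf hf_convex, hv.isTheEntropySolution hf hf_convex,
    hu.isClassicalSolution (hf.differentiable two_ne_zero),
    hv.isClassicalSolution (hf.differentiable two_ne_zero),
    fun t ht => ⟨⟨hu.memUp hp hu₀_mem ht, hu.charSol_strictMono ht⟩,
      hv.memUp hp hv₀_mem ht, hv.charSol_strictMono ht⟩,
    fun t ht => ⟨ConservationLaw.wasserstein_charSol hu hv hp ht,
      ConservationLaw.wasserstein_lt_top hu₀.continuous hv₀.continuous hu₀_incr hv₀_incr hp
        hu₀_mem hv₀_mem⟩⟩
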